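/- Fix $\upsilon>0$ and $\sigma>0$, and let $H(p,q)=\frac{p^2}{2}+\frac{q^4}{4}+\frac{\upsilon}{2}pq$. Let $W$ be a one-dimensional standard Wiener process on a probability space, let $\tau\in(0,1)$ be a step size, $t_n=n\tau$ $(n\in\mathbb N=\{0,1,2,\dots\})$ and $n_t=\max\{n\in\mathbb N:t_n\le t\}$ for $t\ge 0$. Let a solvable one-step method preserving $H$ be given: measurable maps $\mathcal A_\tau,\mathcal B_\tau:\mathbb R^4\to\mathbb R$ and $\psi_\tau,\phi_\tau:\mathbb R^2\to\mathbb R$ such that for all $(p,q)\in\mathbb R^2$ the point $(\bar p,\bar q)=(\psi_\tau(p,q),\phi_\tau(p,q))$ satisfies $$\bar p=p+\mathcal A_\tau(p,q,\bar p,\bar q),\qquad \bar q=q+\mathcal B_\tau(p,q,\bar p,\bar q),\qquad H(\bar p,\bar q)=H(p,q).$$ Starting from a deterministic $(P_0,Q_0)\in\mathbb R^2$, define the splitting scheme recursively: given $(P_n,Q_n)$, let $(\tilde P_{T_n,t},\tilde Q_{T_n,t})_{t\in[t_n,t_{n+1}]}$ be the (continuous) solution of $$d\tilde P_{T_n,t}=-\tfrac{\upsilon}{2}\tilde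 P_{T_n,t}\,dt+\sigma\,dW_t,\qquad d\tilde Q_{T_n,t}=-\tfrac{\upsilon}{2}\tilde Q_{T_n,t}\,dt,\qquad (\tilde P_{T_n,t_n},\tilde Q_{T_n,t_n})=(\psi_\tau(P_n,Q_n),\phi_\tau(P_n,Q_n)),$$ and put $(P_{n+1},Q_{n+1})=(\tilde P_{T_n,t_{n+1}},\tilde Q_{T_n,t_{n+1}})$. Then for every real $p\ge 1$ and every $T>0$ there is a constant $C(p,T)>0$ such that $$\mathbb E\Big[\sup_{t\in[0,T]}\big(|\tilde P_{T_{n_t},t}|^{2p}+|\tilde Q_{T_{n_t},t}|^{4p}\big)\Big]\le C(p,T)\,\big(1+|H(P_0,Q_0)|^p\big),$$ and for every real $p\ge 1$ there is a constant $C(p)>0$ such that $$\sup_{n\in\mathbb N}\mathbb E\big[|P_n|^{2p}+|Q_n|^{4p}\big]\le C(p)\,\big(1+|H(P_0,Q_0)|^p\big).$$ Besides the indicated arguments, the constants depend only on $\upsilon$ and $\sigma$; in particular they do not depend on $\tau$, on the one-step method, on $(P_0,Q_0)$, or on the probability space. -/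

import Mathlib

open MeasureTheory Set
open scoped ENNReal NNReal

namespace SplitLangevin

universe u

/-- The quartic potential `U(q) = q⁴ / 4`. -/
noncomputable def potential (q : ℝ) : ℝ := q ^ 4 / 4

/-- The energy `H₀(p, q) = p² / 2 + U(q)` of the Langevin system. -/
noncomputable def energy (p q : ℝ) : ℝ := p ^ 2 / 2 + potential q

/-- The modified Hamiltonian `H(p, q) = H₀(p, q) + (υ / 2) p q`. -/
noncomputable def hamiltonian (υ p q : ℝ) : ℝ := energy p q + υ / 2 * p * q

/-- A solvable one-step method `(p, q) ↦ (p̄, q̄)` that preserves the Hamiltonian `H`.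
The method is given by (in general implicit) relations
`p̄ = p + A (p, q, p̄, q̄)`, `q̄ = q + B (p, q, p̄, q̄)` with measurable increments `A`, `B`;
solvability means that they are solved by `p̄ = ψ (p, q)`, `q̄ = φ (p, q)` for measurable
functions `ψ`, `φ`. The step size is fixed, and the four functions may depend on it. -/
structure ConservativeStep (υ : ℝ) where
  A : ℝ × ℝ × ℝ × ℝ → ℝ
  B : ℝ × ℝ × ℝ × ℝ → ℝ
  measurable_A : Measurable A
  measurable_B : Measurable B
  ψ : ℝ × ℝ → ℝ
  φ : ℝ × ℝ → ℝ
  measurable_ψ : Measurable ψ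
  measurable_φ : Measurable φ
  ψ_eq : ∀ p q : ℝ, ψ (p, q) = p + A (p, q, ψ (p, q), φ (p, q))
  φ_eq : ∀ p q : ℝ, φ (p, q) = q + B (p, q, ψ (p, q), φ (p, q))
  conserves : ∀ p q : ℝ, hamiltonian υ (ψ (p, q)) (φ (p, q)) = hamiltonian υ p q

/-- The path `t ↦ (x t, y t)` is the solution on `[a, b]`, started from `(x₀, y₀)` at time `a`, of
`dx = -(υ/2) x dt + σ dw`, `dy = -(υ/2) y dt`.
The noise is additive, so the stochastic differential equation is, path by path,
an integral equation for a continuous path. -/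
structure SolvesLinearSDE (υ σ a b x₀ y₀ : ℝ) (w x y : ℝ → ℝ) : Prop where
  continuousOn_x : ContinuousOn x (Icc a b)
  continuousOn_y : ContinuousOn y (Icc a b)
  x_eq : ∀ t ∈ Icc a b, x t = x₀ + (∫ s in a..t, -(υ / 2) * x s) + σ * (w t - w a)
  y_eq : ∀ t ∈ Icc a b, y t = y₀ + ∫ s in a..t, -(υ / 2) * y s

/-- The numerical solution `(P n, Q n)` of the splitting method with step size `τ`, driven by `W`
and started from the deterministic point `(P₀, Q₀)`, together with the inner processes
`(Pt n t, Qt n t)`, where `t` runs through `[n τ, (n + 1) τ]`: a conservative step `S` is applied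
to `(P n, Q n)`, the result is the initial datum at time `n τ` of the linear stochastic
subsystem, and the solution of the latter at time `(n + 1) τ` is `(P (n + 1), Q (n + 1))`. -/
structure IsNumericalSolution {Ω : Type u} [MeasurableSpace Ω] (μ : Measure Ω) (W : ℝ≥0 → Ω → ℝ)
    (υ σ τ : ℝ) (S : ConservativeStep υ) (P₀ Q₀ : ℝ)
    (P Q : ℕ → Ω → ℝ) (Pt Qt : ℕ → ℝ → Ω → ℝ) : Prop where
  init : ∀ᵐ ω ∂μ, P 0 ω = P₀ ∧ Q 0 ω = Q₀
  inner : ∀ᵐ ω ∂μ, ∀ n : ℕ,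
    SolvesLinearSDE υ σ (n * τ) ((n + 1) * τ) (S.ψ (P n ω, Q n ω)) (S.φ (P n ω, Q n ω))
      (fun t => W t.toNNReal ω) (fun t => Pt n t ω) (fun t => Qt n t ω)
  step : ∀ᵐ ω ∂μ, ∀ n : ℕ,
    P (n + 1) ω = Pt n ((n + 1) * τ) ω ∧ Q (n + 1) ω = Qt n ((n + 1) * τ) ω

/-- The index `n_t = max {n : n τ ≤ t}` of the last grid point not after `t`. -/
noncomputable def gridIndex (τ t : ℝ) : ℕ := ⌊t / τ⌋₊

theorem isGreatest_gridIndex {τ t : ℝ} (hτ : 0 < τ) (ht : 0 ≤ t) :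
    IsGreatest {n : ℕ | n * τ ≤ t} (gridIndex τ t) := by
  constructor
  · exact (le_div_iff₀ hτ).1 (Nat.floor_le (div_nonneg ht hτ.le))
  · intro n hn
    exact Nat.le_floor ((le_div_iff₀ hτ).2 hn)

end SplitLangevin

namespace SplitLangevin

open ProbabilityTheory Filter Topology

/-- The probability measure on `[a, t]` with an atom `exp (-θ (t - a))` at `a` and the density
`s ↦ θ exp (-θ (t - s))`. -/
noncomputable def expWeight (θ a t : ℝ) : Measure ℝ :=
  ENNReal.ofReal (Real.exp (-θ * (t - a))) • Measure.dirac a +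
    (volume.restrict (Ioc a t)).withDensity
      (fun s => ENNReal.ofReal (θ * Real.exp (-θ * (t - s))))

theorem integral_expDensity (θ a t : ℝ) :
    ∫ s in a..t, θ * Real.exp (-θ * (t - s)) = 1 - Real.exp (-θ * (t - a)) := by
  have h : ∀ s ∈ uIcc a t, HasDerivAt (fun s => Real.exp (-θ * (t - s)))
      (θ * Real.exp (-θ * (t - s))) s := by
    intro s _
    have h1 : HasDerivAt (fun s : ℝ => -θ * (t - s)) θ s := by
      simpa using ((hasDerivAt_id s).const_sub t).const_mul (-θ)
    simpa [mul_comm] using h1.exp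
  rw [intervalIntegral.integral_eq_sub_of_hasDerivAt h
    (Continuous.intervalIntegrable (by fun_prop) _ _)]
  simp

theorem isProbabilityMeasure_expWeight {θ a t : ℝ} (hθ : 0 ≤ θ) (hat : a ≤ t) :
    IsProbabilityMeasure (expWeight θ a t) := by
  constructor
  have hcont : Continuous fun s => θ * Real.exp (-θ * (t - s)) := by fun_prop
  have h2 : ∫⁻ s in Ioc a t, ENNReal.ofReal (θ * Real.exp (-θ * (t - s)))
      = ENNReal.ofReal (1 - Real.exp (-θ * (t - a))) := by
    rw [← integral_expDensity, intervalIntegral.integral_of_le hat,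
      ofReal_integral_eq_lintegral_ofReal]
    · exact (hcont.integrableOn_Icc).mono_set Ioc_subset_Icc_self
    · exact Filter.Eventually.of_forall fun s => by positivity
  have h1 : Real.exp (-θ * (t - a)) ≤ 1 := by
    rw [Real.exp_le_one_iff]
    nlinarith [mul_nonneg hθ (sub_nonneg.2 hat)]
  rw [expWeight, Measure.add_apply, Measure.smul_apply, withDensity_apply _ MeasurableSet.univ,
    Measure.restrict_univ, h2, measure_univ, smul_eq_mul, mul_one,
    ← ENNReal.ofReal_add (Real.exp_nonneg _) (by linarith)]
  simp

theorem ae_mem_Icc_expWeight {θ a t : ℝ} (hat : a ≤ t) :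
    ∀ᵐ s ∂(expWeight θ a t), s ∈ Icc a t := by
  rw [expWeight, ae_add_measure_iff]
  constructor
  · refine Measure.ae_smul_measure ?_ _
    exact (ae_dirac_iff (p := (· ∈ Icc a t)) measurableSet_Icc).2 ⟨le_rfl, hat⟩
  · refine (withDensity_absolutelyContinuous _ _).ae_le ?_
    filter_upwards [ae_restrict_mem measurableSet_Ioc] with s hs using ⟨hs.1.le, hs.2⟩

theorem integrable_expWeight {θ a t : ℝ} (hθ : 0 ≤ θ) (hat : a ≤ t) {f : ℝ → ℝ}
    (hf : Continuous f) : Integrable f (expWeight θ a t) := by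
  have := isProbabilityMeasure_expWeight hθ hat
  obtain ⟨C, hC⟩ := (isCompact_Icc (a := a) (b := t)).exists_bound_of_continuousOn hf.continuousOn
  refine Integrable.of_bound hf.aestronglyMeasurable C ?_
  filter_upwards [ae_mem_Icc_expWeight hat] with s hs using hC s hs

theorem integral_expWeight {θ a t : ℝ} (hθ : 0 ≤ θ) (hat : a ≤ t) {f : ℝ → ℝ}
    (hf : Continuous f) : ∫ s, f s ∂(expWeight θ a t) =
      Real.exp (-θ * (t - a)) * f a + ∫ s in a..t, θ * Real.exp (-θ * (t - s)) * f s := by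
  have hint := integrable_expWeight hθ hat hf
  rw [expWeight] at hint ⊢
  rw [integral_add_measure (hint.mono_measure (Measure.le_add_right le_rfl))
    (hint.mono_measure (Measure.le_add_left le_rfl)), integral_smul_measure, integral_dirac,
    integral_withDensity_eq_integral_toReal_smul (by fun_prop) (by simp),
    intervalIntegral.integral_of_le hat, ENNReal.toReal_ofReal (Real.exp_nonneg _)]
  simp only [smul_eq_mul]
  congr 1
  refine integral_congr_ae (Filter.Eventually.of_forall fun s => ?_)
  simp only
  rw [ENNReal.toReal_ofReal (by positivity)]

/-- The response on `[a, t]`, started from `0`, of `dx = -θ x dt + σ dw`. -/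
noncomputable def noise (θ σ : ℝ) (w : ℝ → ℝ) (a t : ℝ) : ℝ :=
  ∫ s, σ * (w t - w s) ∂(expWeight θ a t)

theorem noise_eq {θ σ a t : ℝ} (hθ : 0 ≤ θ) (hat : a ≤ t) {w : ℝ → ℝ} (hw : Continuous w) :
    noise θ σ w a t = σ * (w t - Real.exp (-θ * (t - a)) * w a
      - ∫ s in a..t, θ * Real.exp (-θ * (t - s)) * w s) := by
  have h1 : ∫ s in a..t, θ * Real.exp (-θ * (t - s)) * (σ * (w t - w s)) =
      σ * (w t * (1 - Real.exp (-θ * (t - a)))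
        - ∫ s in a..t, θ * Real.exp (-θ * (t - s)) * w s) := by
    rw [← integral_expDensity, ← intervalIntegral.integral_const_mul,
      ← intervalIntegral.integral_sub, ← intervalIntegral.integral_const_mul]
    · exact intervalIntegral.integral_congr fun s _ => by ring
    · exact Continuous.intervalIntegrable (by fun_prop) _ _
    · exact Continuous.intervalIntegrable (by fun_prop) _ _
  rw [noise, integral_expWeight hθ hat (by fun_prop), h1]
  ring

theorem noise_eq' {θ σ a t : ℝ} (hθ : 0 ≤ θ) (hat : a ≤ t) {w : ℝ → ℝ} (hw : Continuous w) :
    noise θ σ w a t = σ * (w t - Real.exp (-θ * (t - a)) * w a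
      - Real.exp (-θ * t) * ∫ s in a..t, θ * Real.exp (θ * s) * w s) := by
  rw [noise_eq hθ hat hw, ← intervalIntegral.integral_const_mul]
  congr 2
  refine intervalIntegral.integral_congr fun s _ => ?_
  have : Real.exp (-θ * (t - s)) = Real.exp (-θ * t) * Real.exp (θ * s) := by
    rw [← Real.exp_add]; congr 1; ring
  simp only [this]
  ring

theorem noise_self {θ σ a : ℝ} (hθ : 0 ≤ θ) {w : ℝ → ℝ} (hw : Continuous w) :
    noise θ σ w a a = 0 := by
  simp [noise_eq hθ le_rfl hw]

theorem noise_trans {θ σ a b t : ℝ} (hθ : 0 ≤ θ) (hab : a ≤ b) (hbt : b ≤ t) {w : ℝ → ℝ}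
    (hw : Continuous w) :
    noise θ σ w a t = Real.exp (-θ * (t - b)) * noise θ σ w a b + noise θ σ w b t := by
  rw [noise_eq' hθ (hab.trans hbt) hw, noise_eq' hθ hab hw, noise_eq' hθ hbt hw,
    ← intervalIntegral.integral_add_adjacent_intervals (b := b)
      (Continuous.intervalIntegrable (by fun_prop) _ _)
      (Continuous.intervalIntegrable (by fun_prop) _ _)]
  have h1 : Real.exp (-θ * (t - a)) = Real.exp (-θ * (t - b)) * Real.exp (-θ * (b - a)) := by
    rw [← Real.exp_add]; congr 1; ring
  have h2 : Real.exp (-θ * t) = Real.exp (-θ * (t - b)) * Real.exp (-θ * b) := by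
    rw [← Real.exp_add]; congr 1; ring
  rw [h1, h2]
  ring

theorem continuousOn_noise {θ σ a : ℝ} (hθ : 0 ≤ θ) {w : ℝ → ℝ} (hw : Continuous w) :
    ContinuousOn (fun t => noise θ σ w a t) (Ici a) := by
  have h : Continuous fun t => ∫ s in a..t, θ * Real.exp (θ * s) * w s :=
    intervalIntegral.continuous_primitive
      (fun _ _ => Continuous.intervalIntegrable (by fun_prop) _ _) a
  refine ContinuousOn.congr (f := fun t => σ * (w t - Real.exp (-θ * (t - a)) * w a
      - Real.exp (-θ * t) * ∫ s in a..t, θ * Real.exp (θ * s) * w s)) ?_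
    fun t ht => noise_eq' hθ ht hw
  exact Continuous.continuousOn (by fun_prop)

/-- Variation of constants for the linear equation with additive noise. -/
theorem eq_exp_mul_add_noise {θ σ a b x₀ : ℝ} (hθ : 0 ≤ θ) {w x : ℝ → ℝ} (hw : Continuous w)
    (hx : ContinuousOn x (Icc a b))
    (heq : ∀ t ∈ Icc a b, x t = x₀ + (∫ s in a..t, -θ * x s) + σ * (w t - w a))
    {t : ℝ} (ht : t ∈ Icc a b) :
    x t = Real.exp (-θ * (t - a)) * x₀ + noise θ σ w a t := by
  have hxt : ContinuousOn x (Icc a t) := hx.mono (Icc_subset_Icc_right ht.2)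
  set z : ℝ → ℝ := fun t => x t - σ * (w t - w a)
  have hz : ContinuousOn z (Icc a t) := by
    have : Continuous fun t => σ * (w t - w a) := by fun_prop
    exact hxt.sub this.continuousOn
  have hzd : ∀ s ∈ Ioo a t, HasDerivAt z (-θ * x s) s := by
    intro s hs
    have hxs : ContinuousAt x s := hxt.continuousAt (Icc_mem_nhds hs.1 hs.2)
    have h1 : HasDerivAt (fun t => ∫ s in a..t, -θ * x s) (-θ * x s) s := by
      refine intervalIntegral.integral_hasDerivAt_right ?_ ?_ ?_
      · refine ContinuousOn.intervalIntegrable ?_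
        rw [uIcc_of_le hs.1.le]
        exact continuousOn_const.mul (hxt.mono (Icc_subset_Icc_right hs.2.le))
      · refine ContinuousOn.stronglyMeasurableAtFilter (s := Ioo a t) isOpen_Ioo ?_ s hs
        exact continuousOn_const.mul (hxt.mono Ioo_subset_Icc_self)
      · exact continuousAt_const.mul hxs
    refine (h1.const_add x₀).congr_of_eventuallyEq ?_
    filter_upwards [Icc_mem_nhds hs.1 hs.2] with r hr
    simp only [z]
    rw [heq r ⟨hr.1, hr.2.trans ht.2⟩]
    ring
  have hFTC := intervalIntegral.integral_eq_sub_of_hasDeriv_right (a := a) (b := t)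
    (f := fun s => Real.exp (θ * s) * z s)
    (f' := fun s => -(σ * (θ * Real.exp (θ * s) * (w s - w a)))) ?_ ?_ ?_
  · have hza : z a = x₀ := by
      have := heq a ⟨le_rfl, ht.1.trans ht.2⟩
      simp only [z, this]
      simp
    have h2 : ∫ s in a..t, θ * Real.exp (θ * s) * (w s - w a)
        = (∫ s in a..t, θ * Real.exp (θ * s) * w s)
          - (Real.exp (θ * t) - Real.exp (θ * a)) * w a := by
      have h3 : ∫ s in a..t, θ * Real.exp (θ * s) = Real.exp (θ * t) - Real.exp (θ * a) := by
        refine intervalIntegral.integral_eq_sub_of_hasDerivAt (f := fun s => Real.exp (θ * s))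
          (fun s _ => ?_)
          (Continuous.intervalIntegrable (by fun_prop) _ _)
        simpa [mul_comm] using ((hasDerivAt_id s).const_mul θ).exp
      rw [← h3, ← intervalIntegral.integral_mul_const, ← intervalIntegral.integral_sub]
      · exact intervalIntegral.integral_congr fun s _ => by ring
      · exact Continuous.intervalIntegrable (by fun_prop) _ _
      · exact Continuous.intervalIntegrable (by fun_prop) _ _
    rw [intervalIntegral.integral_neg, intervalIntegral.integral_const_mul, h2, hza] at hFTC
    have e1 : Real.exp (-θ * t) * Real.exp (θ * t) = 1 := by
      rw [← Real.exp_add]; simp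
    have e2 : Real.exp (-θ * (t - a)) = Real.exp (-θ * t) * Real.exp (θ * a) := by
      rw [← Real.exp_add]; congr 1; ring
    have hxz : x t = z t + σ * (w t - w a) := by simp only [z]; ring
    rw [noise_eq' hθ ht.1 hw, hxz, e2]
    linear_combination (σ * w a - z t) * e1 - Real.exp (-θ * t) * hFTC
  · rw [uIcc_of_le ht.1]
    exact (Continuous.continuousOn (by fun_prop)).mul hz
  · rw [min_eq_left ht.1, max_eq_right ht.1]
    intro s hs
    have h1 : HasDerivAt (fun s => Real.exp (θ * s)) (Real.exp (θ * s) * θ) s := by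
      simpa [mul_comm] using ((hasDerivAt_id s).const_mul θ).exp
    have h2 := h1.mul (hzd s hs)
    refine (h2.congr_deriv ?_).hasDerivWithinAt
    simp only [z]
    ring
  · exact Continuous.intervalIntegrable (by fun_prop) _ _

/-- The information carried by the path of `B` up to time `a`. -/
@[reducible]
def past {Ω : Type*} (B : ℝ → Ω → ℝ) (a : ℝ) : MeasurableSpace Ω :=
  MeasurableSpace.comap (fun ω (s : Iic a) => B s ω) MeasurableSpace.pi

theorem measurable_past {Ω : Type*} (B : ℝ → Ω → ℝ) {s a : ℝ} (h : s ≤ a) :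
    Measurable[past B a] (B s) :=
  @Measurable.comp Ω _ ℝ (past B a) _ _ (fun f : Iic a → ℝ => f ⟨s, h⟩) (fun ω r => B r ω)
    (measurable_pi_apply _) (comap_measurable _)

theorem past_le_of_measurable {Ω : Type*} {B : ℝ → Ω → ℝ} {a : ℝ} {m : MeasurableSpace Ω}
    (h : ∀ s ≤ a, Measurable[m] (B s)) : past B a ≤ m := by
  refine Measurable.comap_le ?_
  exact measurable_pi_lambda _ fun s => h s s.2

theorem past_mono {Ω : Type*} (B : ℝ → Ω → ℝ) : Monotone (past B) := fun _ _ hab =>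
  past_le_of_measurable fun _ hs => measurable_past B (hs.trans hab)

/-- A Brownian motion, indexed by real times, for which every path is continuous and every
time marginal is measurable. -/
structure IsRegularBrownian {Ω : Type*} [MeasurableSpace Ω] (B : ℝ → Ω → ℝ) (μ : Measure Ω) :
    Prop where
  measurable : ∀ t, Measurable (B t)
  continuous : ∀ ω, Continuous fun t => B t ω
  hasLaw_sub : ∀ {s t : ℝ}, 0 ≤ s → s ≤ t →
    HasLaw (B t - B s) (gaussianReal 0 (t - s).toNNReal) μ
  indep_sub : ∀ {a s t : ℝ}, 0 ≤ a → a ≤ s → s ≤ t →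
    Indep (past B a) (MeasurableSpace.comap (B t - B s) inferInstance) μ

theorem exists_continuous_measurable_modification {Ω : Type*} [MeasurableSpace Ω] {μ : Measure Ω}
    {W : ℝ≥0 → Ω → ℝ} (hm : ∀ t, AEMeasurable (W t) μ) (hc : ∀ᵐ ω ∂μ, Continuous (W · ω)) :
    ∃ X : ℝ≥0 → Ω → ℝ, (∀ t, Measurable (X t)) ∧ (∀ ω, Continuous (X · ω)) ∧
      ∀ᵐ ω ∂μ, ∀ t, X t ω = W t ω := by
  have hq : ∀ᵐ ω ∂μ, ∀ n, W (TopologicalSpace.denseSeq ℝ≥0 n) ω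
      = (hm (TopologicalSpace.denseSeq ℝ≥0 n)).mk _ ω :=
    ae_all_iff.2 fun n => (hm _).ae_eq_mk
  obtain ⟨G, hGae, hGm, hG⟩ := (hc.and hq).exists_measurable_mem
  classical
  refine ⟨fun t => G.indicator (W t), fun t => ?_, fun ω => ?_, ?_⟩
  · have ht : t ∈ closure (range (TopologicalSpace.denseSeq ℝ≥0)) :=
      TopologicalSpace.denseRange_denseSeq _ t
    obtain ⟨x, hx, hxt⟩ := mem_closure_iff_seq_limit.1 ht
    choose k hk using hx
    refine measurable_of_tendsto_metrizable
      (f := fun n => G.indicator ((hm (TopologicalSpace.denseSeq ℝ≥0 (k n))).mk _))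
      (fun n => (hm _).measurable_mk.indicator hGm) ?_
    refine tendsto_pi_nhds.2 fun ω => ?_
    by_cases hω : ω ∈ G
    · simp only [indicator_of_mem hω]
      simp_rw [← (hG ω hω).2, hk]
      exact ((hG ω hω).1.tendsto t).comp hxt
    · simp [hω]
  · by_cases hω : ω ∈ G
    · simpa only [indicator_of_mem hω] using (hG ω hω).1
    · simpa only [indicator_of_notMem hω] using continuous_const
  · filter_upwards [hGae] with ω hω t using indicator_of_mem hω _

theorem exists_isRegularBrownian {Ω : Type*} [MeasurableSpace Ω] {μ : Measure Ω}
    {W : ℝ≥0 → Ω → ℝ} (hW : IsBrownianReal W μ) :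
    ∃ B : ℝ → Ω → ℝ, IsRegularBrownian B μ ∧ ∀ᵐ ω ∂μ, ∀ t, B t ω = W t.toNNReal ω := by
  obtain ⟨X, hXm, hXc, hXW⟩ := exists_continuous_measurable_modification hW.aemeasurable hW.cont
  have hX : IsPreBrownianReal X μ := by
    refine hW.toIsPreBrownianReal.congr fun t => ?_
    filter_upwards [hXW] with ω hω using (hω t).symm
  refine ⟨fun t => X t.toNNReal, ⟨fun t => hXm _, fun ω => ?_, ?_, ?_⟩, ?_⟩
  · exact (hXc ω).comp continuous_real_toNNReal
  · intro s t hs hst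
    have h := hX.hasLaw_sub t.toNNReal s.toNNReal
    convert h using 2
    apply NNReal.coe_injective
    rw [coe_nndist, Real.dist_eq, Real.coe_toNNReal _ (sub_nonneg.2 hst)]
    simp only [NNReal.val_eq_coe, Real.coe_toNNReal _ hs, Real.coe_toNNReal _ (hs.trans hst)]
    rw [abs_of_nonneg (sub_nonneg.2 hst)]
  · intro a s t ha has hst
    have h := (hX.indepFun_shift a.toNNReal).symm
    have h' := h.comp
      (φ := fun (f : Iic a.toNNReal → ℝ) (r : Iic a) =>
        f ⟨r.1.toNNReal, Real.toNNReal_le_toNNReal r.2⟩)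
      (ψ := fun f : ℝ≥0 → ℝ =>
        f (t.toNNReal - a.toNNReal) - f (s.toNNReal - a.toNNReal))
      (by fun_prop) (by fun_prop)
    have e1 : a.toNNReal + (t.toNNReal - a.toNNReal) = t.toNNReal :=
      add_tsub_cancel_of_le (Real.toNNReal_le_toNNReal (has.trans hst))
    have e2 : a.toNNReal + (s.toNNReal - a.toNNReal) = s.toNNReal :=
      add_tsub_cancel_of_le (Real.toNNReal_le_toNNReal has)
    convert h'
    simp [Function.comp_def, e1, e2]
    rfl
  · filter_upwards [hXW] with ω hω t using hω _

theorem lintegral_exp_quadratic_gaussianReal_le {β l : ℝ} {v : ℝ≥0} (hl : 0 ≤ l)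
    (hlv : l * v ≤ 1 / 2) :
    ∫⁻ x, ENNReal.ofReal (Real.exp (β * x + l / 2 * x ^ 2)) ∂(gaussianReal 0 v)
      ≤ ENNReal.ofReal (Real.exp ((l + β ^ 2) * v)) := by
  by_cases hv : v = 0
  · subst hv
    rw [gaussianReal_zero_var, lintegral_dirac]
    simp
  have hv0 : (0 : ℝ) < v := lt_of_le_of_ne v.2 fun h => hv (NNReal.coe_injective h.symm)
  have hd : 0 < 1 - l * v := by linarith
  have hd0 : 1 - (v : ℝ) * l ≠ 0 := by rw [mul_comm]; exact hd.ne'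
  have hd1 : 1 - l * (v : ℝ) ≠ 0 := hd.ne'
  set v' : ℝ≥0 := ⟨v / (1 - l * v), by positivity⟩ with hv'
  have hv'r : (v' : ℝ) = v / (1 - l * v) := rfl
  have hv'0 : v' ≠ 0 := by
    intro h
    have : (v' : ℝ) = 0 := by rw [h]; rfl
    rw [hv'r] at this
    exact absurd this (by positivity)
  set c : ℝ := (√(1 - l * v))⁻¹ * Real.exp (β ^ 2 * v / (2 * (1 - l * v))) with hc
  have hpdf : ∀ x, gaussianPDF 0 v x * ENNReal.ofReal (Real.exp (β * x + l / 2 * x ^ 2))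
      = ENNReal.ofReal c * gaussianPDF (β * v') v' x := by
    intro x
    rw [gaussianPDF, gaussianPDF, ← ENNReal.ofReal_mul (gaussianPDFReal_nonneg _ _ _),
      ← ENNReal.ofReal_mul (by positivity)]
    congr 1
    rw [gaussianPDFReal, gaussianPDFReal, hc, hv'r]
    have hsq : √(2 * Real.pi * (v / (1 - l * v))) = √(2 * Real.pi * v) / √(1 - l * v) := by
      rw [← Real.sqrt_div (by positivity)]; congr 1; ring
    have hs0 : √(1 - l * v) ≠ 0 := (Real.sqrt_pos.2 hd).ne'
    have hs2 : √(1 - (v : ℝ) * l) ≠ 0 := by rw [mul_comm]; exact hs0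
    have hs1 : √(2 * Real.pi * v) ≠ 0 := (Real.sqrt_pos.2 (by positivity)).ne'
    rw [hsq]
    have hE : Real.exp (β ^ 2 * v / (2 * (1 - l * v)))
        * Real.exp (-(x - β * (v / (1 - l * v))) ^ 2 / (2 * (v / (1 - l * v))))
        = Real.exp (-(x - 0) ^ 2 / (2 * v)) * Real.exp (β * x + l / 2 * x ^ 2) := by
      rw [← Real.exp_add, ← Real.exp_add]
      congr 1
      field_simp
      ring
    calc (√(2 * Real.pi * v))⁻¹ * Real.exp (-(x - 0) ^ 2 / (2 * v))
          * Real.exp (β * x + l / 2 * x ^ 2)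
        = (√(2 * Real.pi * v))⁻¹ * (Real.exp (β ^ 2 * v / (2 * (1 - l * v)))
        * Real.exp (-(x - β * (v / (1 - l * v))) ^ 2 / (2 * (v / (1 - l * v))))) := by
          rw [hE]; ring
      _ = _ := by
        rw [inv_div, div_eq_mul_inv]
        field_simp
  rw [gaussianReal_of_var_ne_zero _ hv, lintegral_withDensity_eq_lintegral_mul _
    (measurable_gaussianPDF _ _) (by fun_prop)]
  simp only [Pi.mul_apply, hpdf]
  rw [lintegral_const_mul _ (measurable_gaussianPDF _ _), lintegral_gaussianPDF_eq_one _ hv'0,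
    mul_one]
  refine ENNReal.ofReal_le_ofReal ?_
  have h1 : (√(1 - l * v))⁻¹ ≤ Real.exp (l * v) := by
    have h2 : Real.exp (-(l * v)) ≤ √(1 - l * v) := by
      refine Real.le_sqrt_of_sq_le ?_
      rw [← Real.exp_nat_mul, ← Real.log_le_log_iff (Real.exp_pos _) hd, Real.log_exp]
      have h3 := Real.one_sub_inv_le_log_of_pos hd
      have h4 : (1 - l * v)⁻¹ ≤ 1 + 2 * (l * v) := by
        rw [inv_le_iff_one_le_mul₀ hd]
        have h5 : 0 ≤ l * (v : ℝ) := mul_nonneg hl v.2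
        nlinarith [mul_nonneg h5 (sub_nonneg.2 hlv)]
      push_cast
      linarith
    calc (√(1 - l * v))⁻¹ ≤ (Real.exp (-(l * v)))⁻¹ := inv_anti₀ (Real.exp_pos _) h2
      _ = Real.exp (l * v) := by rw [Real.exp_neg, inv_inv]
  have h2 : β ^ 2 * v / (2 * (1 - l * v)) ≤ β ^ 2 * v :=
    div_le_self (by positivity) (by linarith)
  calc c ≤ Real.exp (l * v) * Real.exp (β ^ 2 * v) := by
        rw [hc]; gcongr
    _ = Real.exp ((l + β ^ 2) * v) := by rw [← Real.exp_add]; congr 1; ring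

theorem convexOn_exp_quadratic {β l : ℝ} (hl : 0 ≤ l) :
    ConvexOn ℝ univ fun y : ℝ => Real.exp (β * y + l / 2 * y ^ 2) := by
  refine ⟨convex_univ, fun x _ y _ a b ha hb hab => ?_⟩
  refine le_trans (Real.exp_le_exp.2 ?_)
    (convexOn_exp.2 (mem_univ (β * x + l / 2 * x ^ 2)) (mem_univ (β * y + l / 2 * y ^ 2)) ha hb hab)
  obtain rfl : b = 1 - a := by linarith
  simp only [smul_eq_mul]
  have : 0 ≤ l / 2 * (a * (1 - a) * (x - y) ^ 2) := by positivity
  nlinarith [this]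

theorem exp_quadratic_noise_le {θ σ a t β l : ℝ} (hθ : 0 ≤ θ) (hat : a ≤ t) (hl : 0 ≤ l)
    {w : ℝ → ℝ} (hw : Continuous w) :
    ENNReal.ofReal (Real.exp (β * noise θ σ w a t + l / 2 * noise θ σ w a t ^ 2)) ≤
      ∫⁻ s, ENNReal.ofReal (Real.exp (β * (σ * (w t - w s)) + l / 2 * (σ * (w t - w s)) ^ 2))
        ∂(expWeight θ a t) := by
  have := isProbabilityMeasure_expWeight hθ hat
  rw [← ofReal_integral_eq_lintegral_ofReal (integrable_expWeight hθ hat (by fun_prop))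
    (Eventually.of_forall fun s => (Real.exp_nonneg _))]
  refine ENNReal.ofReal_le_ofReal ?_
  exact (convexOn_exp_quadratic (β := β) hl).map_integral_le (Continuous.continuousOn (by fun_prop))
    isClosed_univ (by simp) (integrable_expWeight hθ hat (by fun_prop))
    (integrable_expWeight hθ hat (by fun_prop))

theorem measurable_noise {Ω : Type*} [MeasurableSpace Ω] {B : ℝ → Ω → ℝ} {θ σ a t : ℝ}
    (hθ : 0 ≤ θ) (hat : a ≤ t)
    (hm : ∀ s ≤ t, Measurable (B s)) (hc : ∀ ω, Continuous fun s => B s ω) :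
    Measurable fun ω => noise θ σ (fun s => B s ω) a t := by
  have := isProbabilityMeasure_expWeight hθ hat
  have hj : Measurable (Function.uncurry fun (s : ℝ) (ω : Ω) => B (min s t) ω) :=
    measurable_uncurry_of_continuous_of_measurable (fun ω => by
      have := hc ω; fun_prop) fun s => hm _ (min_le_right _ _)
  have hj' : Measurable fun z : Ω × ℝ => σ * (B t z.1 - B (min z.2 t) z.1) := by
    have h1 := hj.comp measurable_swap
    have h2 : Measurable fun z : Ω × ℝ => B t z.1 := (hm t le_rfl).comp measurable_fst
    exact (h2.sub h1).const_mul σ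
  have h := (hj'.stronglyMeasurable.integral_prod_right' (ν := expWeight θ a t)).measurable
  convert h using 2 with ω
  refine integral_congr_ae ?_
  filter_upwards [ae_mem_Icc_expWeight hat] with s hs
  rw [min_eq_left hs.2]

theorem measurable_past_noise {Ω : Type*} {B : ℝ → Ω → ℝ} {θ σ a t : ℝ}
    (hθ : 0 ≤ θ) (hat : a ≤ t) (hc : ∀ ω, Continuous fun s => B s ω) :
    Measurable[past B t] fun ω => noise θ σ (fun s => B s ω) a t :=
  @measurable_noise Ω (past B t) B θ σ a t hθ hat (fun _ hs => measurable_past B hs) hc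

section Increment

variable {Ω : Type*} [MeasurableSpace Ω] {μ : Measure Ω}
  {B : ℝ → Ω → ℝ}

theorem IsRegularBrownian.past_le (hB : IsRegularBrownian B μ) (a : ℝ) :
    past B a ≤ ‹MeasurableSpace Ω› :=
  past_le_of_measurable fun s _ => hB.measurable s

theorem lintegral_mul_exp_quadratic_increment_le [IsProbabilityMeasure μ]
    (hB : IsRegularBrownian B μ) {σ a s t l : ℝ}
    (ha : 0 ≤ a) (has : a ≤ s) (hst : s ≤ t) (hl : 0 ≤ l) (hlt : l * σ ^ 2 * (t - a) ≤ 1 / 2)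
    {u : Ω → ℝ≥0∞} {β : Ω → ℝ} (hu : Measurable[past B a] u) (hβ : Measurable[past B a] β) :
    ∫⁻ ω, u ω * ENNReal.ofReal (Real.exp (β ω * (σ * (B t ω - B s ω))
        + l / 2 * (σ * (B t ω - B s ω)) ^ 2)) ∂μ
      ≤ ∫⁻ ω, u ω * ENNReal.ofReal (Real.exp ((l + β ω ^ 2) * σ ^ 2 * (t - a))) ∂μ := by
  set U : Ω → ℝ≥0∞ × ℝ := fun ω => (u ω, β ω)
  have hU : Measurable[past B a] U := hu.prodMk hβ
  have hU' : Measurable U := hU.mono (hB.past_le a) le_rfl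
  have hG : Measurable (B t - B s) := (hB.measurable t).sub (hB.measurable s)
  have hind : IndepFun U (B t - B s) μ :=
    indep_of_indep_of_le_left (hB.indep_sub ha has hst) hU.comap_le
  set F : (ℝ≥0∞ × ℝ) × ℝ → ℝ≥0∞ := fun z =>
    z.1.1 * ENNReal.ofReal (Real.exp (z.1.2 * (σ * z.2) + l / 2 * (σ * z.2) ^ 2)) with hF
  have hFm : Measurable F := by fun_prop
  have h1 : ∫⁻ ω, u ω * ENNReal.ofReal (Real.exp (β ω * (σ * (B t ω - B s ω))
        + l / 2 * (σ * (B t ω - B s ω)) ^ 2)) ∂μ = ∫⁻ ω, F (U ω, (B t - B s) ω) ∂μ := rfl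
  rw [h1, ← lintegral_map (f := F) (g := fun ω => (U ω, (B t - B s) ω)) hFm (hU'.prodMk hG),
    (indepFun_iff_map_prod_eq_prod_map_map hU'.aemeasurable hG.aemeasurable).1 hind,
    lintegral_prod _ hFm.aemeasurable, lintegral_map hFm.lintegral_prod_right' hU',
    (hB.hasLaw_sub (ha.trans has) hst).map_eq]
  refine lintegral_mono fun ω => ?_
  have hv : ((t - s).toNNReal : ℝ) = t - s := Real.coe_toNNReal _ (sub_nonneg.2 hst)
  have hle : t - s ≤ t - a := by linarith
  simp only [hF, U]
  rw [lintegral_const_mul _ (by fun_prop)]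
  gcongr
  have h2 := lintegral_exp_quadratic_gaussianReal_le (β := β ω * σ) (l := l * σ ^ 2)
    (v := (t - s).toNNReal) (by positivity) (by
      rw [hv]
      exact le_trans (by gcongr) hlt)
  refine le_trans (le_of_eq ?_) (h2.trans (ENNReal.ofReal_le_ofReal (Real.exp_le_exp.2 ?_)))
  · refine lintegral_congr fun x => ?_
    congr 2
    ring
  · rw [hv]
    calc (l * σ ^ 2 + (β ω * σ) ^ 2) * (t - s) = (l + β ω ^ 2) * σ ^ 2 * (t - s) := by ring
      _ ≤ _ := by gcongr

theorem lintegral_mul_exp_quadratic_noise_le [IsProbabilityMeasure μ]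
    (hB : IsRegularBrownian B μ) {θ σ a t l : ℝ}
    (hθ : 0 ≤ θ) (ha : 0 ≤ a) (hat : a ≤ t) (hl : 0 ≤ l) (hlt : l * σ ^ 2 * (t - a) ≤ 1 / 2)
    {u : Ω → ℝ≥0∞} {β : Ω → ℝ} (hu : Measurable[past B a] u) (hβ : Measurable[past B a] β) :
    ∫⁻ ω, u ω * ENNReal.ofReal (Real.exp (β ω * noise θ σ (fun s => B s ω) a t
        + l / 2 * noise θ σ (fun s => B s ω) a t ^ 2)) ∂μ
      ≤ ∫⁻ ω, u ω * ENNReal.ofReal (Real.exp ((l + β ω ^ 2) * σ ^ 2 * (t - a))) ∂μ := by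
  have := isProbabilityMeasure_expWeight hθ hat
  have hu' : Measurable u := hu.mono (hB.past_le a) le_rfl
  have hβ' : Measurable β := hβ.mono (hB.past_le a) le_rfl
  have hj : Measurable fun z : Ω × ℝ => B z.2 z.1 :=
    (measurable_uncurry_of_continuous_of_measurable (u := B) hB.continuous
      hB.measurable).comp measurable_swap
  have hjt : Measurable fun z : Ω × ℝ => B t z.1 := (hB.measurable t).comp measurable_fst
  have hju : Measurable fun z : Ω × ℝ => u z.1 := hu'.comp measurable_fst
  have hjβ : Measurable fun z : Ω × ℝ => β z.1 := hβ'.comp measurable_fst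
  have hjm : Measurable fun z : Ω × ℝ => u z.1 * ENNReal.ofReal (Real.exp
      (β z.1 * (σ * (B t z.1 - B z.2 z.1)) + l / 2 * (σ * (B t z.1 - B z.2 z.1)) ^ 2)) := by
    have hd := (hjt.sub hj).const_mul σ
    exact hju.mul (ENNReal.measurable_ofReal.comp (Real.measurable_exp.comp
      ((hjβ.mul hd).add ((hd.pow_const 2).const_mul _))))
  calc _ ≤ ∫⁻ ω, ∫⁻ s, u ω * ENNReal.ofReal (Real.exp (β ω * (σ * (B t ω - B s ω))
        + l / 2 * (σ * (B t ω - B s ω)) ^ 2)) ∂(expWeight θ a t) ∂μ := by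
        refine lintegral_mono fun ω => ?_
        rw [lintegral_const_mul]
        · exact mul_le_mul_right (exp_quadratic_noise_le hθ hat hl (hB.continuous ω)) _
        · have := hB.continuous ω
          exact (ENNReal.continuous_ofReal.comp (by fun_prop)).measurable
    _ = ∫⁻ s, ∫⁻ ω, u ω * ENNReal.ofReal (Real.exp (β ω * (σ * (B t ω - B s ω))
        + l / 2 * (σ * (B t ω - B s ω)) ^ 2)) ∂μ ∂(expWeight θ a t) :=
        lintegral_lintegral_swap hjm.aemeasurable
    _ ≤ ∫⁻ s, ∫⁻ ω, u ω * ENNReal.ofReal (Real.exp ((l + β ω ^ 2) * σ ^ 2 * (t - a))) ∂μ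
          ∂(expWeight θ a t) := by
        refine lintegral_mono_ae ?_
        filter_upwards [ae_mem_Icc_expWeight hat] with s hs
        exact lintegral_mul_exp_quadratic_increment_le hB ha hs.1 hs.2 hl hlt hu hβ
    _ = _ := by simp

end Increment

/-- The Hamiltonian, shifted by a constant that makes it at least `1`. -/
noncomputable def shiftedHamiltonian (υ p q : ℝ) : ℝ := hamiltonian υ p q + (υ ^ 4 / 8 + 1)

theorem le_shiftedHamiltonian (υ p q : ℝ) :
    p ^ 2 / 4 + q ^ 4 / 8 + 1 ≤ shiftedHamiltonian υ p q := by
  rw [shiftedHamiltonian, hamiltonian, energy, potential]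
  nlinarith [sq_nonneg (p / 2 + υ / 2 * q), sq_nonneg (q ^ 2 - υ ^ 2)]

theorem shiftedHamiltonian_nonneg (υ p q : ℝ) : 0 ≤ shiftedHamiltonian υ p q :=
  le_trans (by positivity) (le_shiftedHamiltonian υ p q)

theorem sq_add_le_shiftedHamiltonian (υ p q : ℝ) :
    (p + υ / 2 * q) ^ 2 ≤ (10 + υ ^ 4) * shiftedHamiltonian υ p q := by
  have h := le_shiftedHamiltonian υ p q
  have h4 : 0 ≤ υ ^ 4 := by positivity
  have h1 : 1 ≤ shiftedHamiltonian υ p q := le_trans (by nlinarith [sq_nonneg p, sq_nonneg (q ^ 2)]) h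
  nlinarith [sq_nonneg (p - υ / 2 * q), sq_nonneg (q ^ 2 - υ ^ 2),
    mul_nonneg h4 (sub_nonneg.2 h1)]

theorem shiftedHamiltonian_flow_le {e : ℝ} (he : e ^ 2 ≤ 1) (υ p q N : ℝ) :
    shiftedHamiltonian υ (e * p + N) (e * q) ≤
      e ^ 2 * shiftedHamiltonian υ p q + (1 - e ^ 2) * (υ ^ 4 / 8 + 1)
        + (e * (p + υ / 2 * q) * N + N ^ 2 / 2) := by
  have h : 0 ≤ e ^ 2 * (1 - e ^ 2) * q ^ 4 :=
    mul_nonneg (mul_nonneg (sq_nonneg e) (sub_nonneg.2 he)) (by positivity)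
  rw [shiftedHamiltonian, shiftedHamiltonian, hamiltonian, hamiltonian, energy, energy, potential,
    potential]
  nlinarith [h]

/-- The exponent for which the exponential moments of the energy are controlled. -/
noncomputable def expRate (υ σ : ℝ) : ℝ :=
  (1 - Real.exp (-υ)) / (2 * (10 + υ ^ 4) * σ ^ 2)

/-- The growth rate of the exponential moments of the energy. -/
noncomputable def growthRate (υ σ : ℝ) : ℝ :=
  expRate υ σ * (υ * (υ ^ 4 / 8 + 1) + σ ^ 2)

theorem one_sub_exp_neg_pos {υ : ℝ} (hυ : 0 < υ) : 0 < 1 - Real.exp (-υ) :=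
  sub_pos.2 (Real.exp_lt_one_iff.2 (by linarith))

theorem expRate_pos {υ σ : ℝ} (hυ : 0 < υ) (hσ : 0 < σ) : 0 < expRate υ σ := by
  have := one_sub_exp_neg_pos hυ
  rw [expRate]
  positivity

theorem growthRate_pos {υ σ : ℝ} (hυ : 0 < υ) (hσ : 0 < σ) : 0 < growthRate υ σ := by
  have := expRate_pos hυ hσ
  rw [growthRate]
  positivity

theorem expRate_mul {υ σ : ℝ} (hσ : 0 < σ) :
    expRate υ σ * σ ^ 2 * (10 + υ ^ 4) = (1 - Real.exp (-υ)) / 2 := by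
  rw [expRate]
  field_simp

theorem expRate_mul_sq_le {υ σ : ℝ} (hυ : 0 < υ) (hσ : 0 < σ) :
    expRate υ σ * σ ^ 2 ≤ 1 / 2 := by
  have h1 := expRate_mul (υ := υ) hσ
  have h2 := expRate_pos hυ hσ
  have h3 : 0 ≤ expRate υ σ * σ ^ 2 := by positivity
  have h4 : 0 ≤ υ ^ 4 := by positivity
  nlinarith [Real.exp_pos (-υ), mul_nonneg h3 h4]

theorem exp_neg_mul_le {υ h : ℝ} (h0 : 0 ≤ h) (h1 : h ≤ 1) :
    Real.exp (-υ * h) ≤ 1 - (1 - Real.exp (-υ)) * h := by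
  have := convexOn_exp.2 (mem_univ 0) (mem_univ (-υ)) (sub_nonneg.2 h1) h0 (by ring)
  simp only [smul_eq_mul, mul_zero, zero_add, Real.exp_zero, mul_one] at this
  rw [mul_comm (-υ) h]
  linarith

section OneStep

variable {Ω : Type*} [MeasurableSpace Ω] {μ : Measure Ω} [IsProbabilityMeasure μ]
  {B : ℝ → Ω → ℝ}

/-- The exponential Lyapunov estimate for the linear stochastic subsystem. -/
theorem lintegral_mul_exp_shiftedHamiltonian_le (hB : IsRegularBrownian B μ) {υ σ a t : ℝ}
    (hυ : 0 < υ) (hσ : 0 < σ) (ha : 0 ≤ a) (hat : a ≤ t) (hta : t ≤ a + 1)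
    {u : Ω → ℝ≥0∞} {x y : Ω → ℝ} (hu : Measurable[past B a] u)
    (hx : Measurable[past B a] x) (hy : Measurable[past B a] y) :
    ∫⁻ ω, u ω * ENNReal.ofReal (Real.exp (expRate υ σ * shiftedHamiltonian υ
        (Real.exp (-(υ / 2) * (t - a)) * x ω + noise (υ / 2) σ (fun s => B s ω) a t)
        (Real.exp (-(υ / 2) * (t - a)) * y ω))) ∂μ
      ≤ ∫⁻ ω, u ω * ENNReal.ofReal (Real.exp ((1 - (1 - Real.exp (-υ)) / 2 * (t - a))
          * (expRate υ σ * shiftedHamiltonian υ (x ω) (y ω))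
          + growthRate υ σ * (t - a))) ∂μ := by
  set l := expRate υ σ with hl
  set e := Real.exp (-(υ / 2) * (t - a)) with he
  set c := υ ^ 4 / 8 + 1 with hc
  have hl0 : 0 < l := expRate_pos hυ hσ
  have hh0 : 0 ≤ t - a := sub_nonneg.2 hat
  have hh1 : t - a ≤ 1 := by linarith
  have hc0 : 0 < c := by positivity
  have he2 : e ^ 2 = Real.exp (-υ * (t - a)) := by
    rw [he, ← Real.exp_nat_mul]; congr 1; push_cast; ring
  have he2le : e ^ 2 ≤ 1 - (1 - Real.exp (-υ)) * (t - a) := he2 ▸ exp_neg_mul_le hh0 hh1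
  have he2le1 : e ^ 2 ≤ 1 := by nlinarith [one_sub_exp_neg_pos hυ]
  have he2ge : 1 - e ^ 2 ≤ υ * (t - a) := by
    have := Real.add_one_le_exp (-υ * (t - a))
    rw [he2]; linarith
  have hV : Measurable[past B a] fun ω => shiftedHamiltonian υ (x ω) (y ω) := by
    unfold shiftedHamiltonian hamiltonian energy potential
    fun_prop
  have hlt : l * σ ^ 2 * (t - a) ≤ 1 / 2 := by
    have h1 := expRate_mul_sq_le hυ hσ
    have h2 : 0 ≤ l * σ ^ 2 := by positivity
    calc l * σ ^ 2 * (t - a) ≤ l * σ ^ 2 * 1 := by gcongr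
      _ ≤ 1 / 2 := by rw [mul_one]; exact h1
  have hu' : Measurable[past B a] fun ω => u ω * ENNReal.ofReal (Real.exp
      (l * (e ^ 2 * shiftedHamiltonian υ (x ω) (y ω) + (1 - e ^ 2) * c))) := by
    refine hu.mul (ENNReal.measurable_ofReal.comp (Real.measurable_exp.comp ?_))
    exact ((hV.const_mul _).add_const _).const_mul _
  have hβ : Measurable[past B a] fun ω => l * e * (x ω + υ / 2 * y ω) := by fun_prop
  calc _ ≤ ∫⁻ ω, u ω * ENNReal.ofReal (Real.exp
            (l * (e ^ 2 * shiftedHamiltonian υ (x ω) (y ω) + (1 - e ^ 2) * c))) *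
          ENNReal.ofReal (Real.exp (l * e * (x ω + υ / 2 * y ω)
              * noise (υ / 2) σ (fun s => B s ω) a t
            + l / 2 * noise (υ / 2) σ (fun s => B s ω) a t ^ 2)) ∂μ := by
        refine lintegral_mono fun ω => ?_
        simp only
        rw [mul_assoc, ← ENNReal.ofReal_mul (Real.exp_nonneg _), ← Real.exp_add]
        refine mul_le_mul_right (ENNReal.ofReal_le_ofReal (Real.exp_le_exp.2 ?_)) _
        have := mul_le_mul_of_nonneg_left (shiftedHamiltonian_flow_le he2le1 υ (x ω) (y ω)
          (noise (υ / 2) σ (fun s => B s ω) a t)) hl0.le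
        refine this.trans (le_of_eq ?_)
        rw [hc]
        ring
    _ ≤ _ := lintegral_mul_exp_quadratic_noise_le hB (by positivity) ha hat hl0.le hlt hu' hβ
    _ ≤ _ := by
        refine lintegral_mono fun ω => ?_
        simp only
        rw [mul_assoc, ← ENNReal.ofReal_mul (Real.exp_nonneg _), ← Real.exp_add]
        refine mul_le_mul_right (ENNReal.ofReal_le_ofReal (Real.exp_le_exp.2 ?_)) _
        set V := shiftedHamiltonian υ (x ω) (y ω)
        have hV0 : 0 ≤ V := shiftedHamiltonian_nonneg _ _ _
        have hα : (x ω + υ / 2 * y ω) ^ 2 ≤ (10 + υ ^ 4) * V :=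
          sq_add_le_shiftedHamiltonian υ (x ω) (y ω)
        have h1 : l * (e ^ 2 * V) ≤ l * ((1 - (1 - Real.exp (-υ)) * (t - a)) * V) := by gcongr
        have h2 : l * ((1 - e ^ 2) * c) ≤ l * (υ * (t - a) * c) := by gcongr
        have h3 : (l * e * (x ω + υ / 2 * y ω)) ^ 2 * σ ^ 2 * (t - a)
            ≤ l * ((1 - Real.exp (-υ)) / 2) * V * (t - a) := by
          calc (l * e * (x ω + υ / 2 * y ω)) ^ 2 * σ ^ 2 * (t - a)
              = e ^ 2 * (l ^ 2 * σ ^ 2 * (t - a)) * (x ω + υ / 2 * y ω) ^ 2 := by ring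
            _ ≤ 1 * (l ^ 2 * σ ^ 2 * (t - a)) * ((10 + υ ^ 4) * V) := by gcongr
            _ = l * (l * σ ^ 2 * (10 + υ ^ 4)) * V * (t - a) := by ring
            _ = _ := by rw [hl, expRate_mul hσ]
        have hg : growthRate υ σ = l * (υ * c + σ ^ 2) := rfl
        rw [hg]
        linarith

end OneStep

section Maximal

variable {Ω : Type*} [mΩ : MeasurableSpace Ω] {μ : Measure Ω}

/-- The maximal inequality for a nonnegative supermartingale in discrete time. -/
theorem mul_measure_exists_le_add_setLIntegral_le {Z : ℕ → Ω → ℝ≥0∞} {m : ℕ → MeasurableSpace Ω}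
    (hmono : Monotone m) (hle : ∀ k, m k ≤ mΩ) (hZ : ∀ k, Measurable[m k] (Z k))
    (hstep : ∀ k A, MeasurableSet[m k] A → ∫⁻ ω in A, Z (k + 1) ω ∂μ ≤ ∫⁻ ω in A, Z k ω ∂μ)
    (x : ℝ≥0∞) (n : ℕ) :
    x * μ {ω | ∃ k ≤ n, x ≤ Z k ω} + ∫⁻ ω in {ω | ∃ k ≤ n, x ≤ Z k ω}ᶜ, Z n ω ∂μ
      ≤ ∫⁻ ω, Z 0 ω ∂μ := by
  have hcheb : ∀ (k : ℕ) (D : Set Ω), MeasurableSet D → (∀ ω ∈ D, x ≤ Z k ω) →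
      x * μ D ≤ ∫⁻ ω in D, Z k ω ∂μ := by
    intro k D hD h
    rw [← setLIntegral_const]
    exact setLIntegral_mono' hD h
  have hmeas : ∀ n, MeasurableSet[m n] {ω | ∃ k ≤ n, x ≤ Z k ω} := by
    intro n
    have : {ω | ∃ k ≤ n, x ≤ Z k ω} = ⋃ k ∈ Iic n, {ω | x ≤ Z k ω} := by ext; simp
    rw [this]
    refine MeasurableSet.biUnion (to_countable _) fun k hk => ?_
    exact hmono hk _ (hZ k measurableSet_Ici)
  induction n with
  | zero =>
    have hS := hle 0 _ (hmeas 0)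
    refine le_trans ?_ (lintegral_add_compl (Z 0) hS).le
    exact add_le_add
      (hcheb 0 _ hS fun ω ⟨k, hk, h⟩ => by rwa [Nat.le_zero.1 hk] at h) le_rfl
  | succ n ih =>
    set S := {ω | ∃ k ≤ n, x ≤ Z k ω} with hSdef
    set E := {ω | x ≤ Z (n + 1) ω}
    have hS : MeasurableSet S := hle n _ (hmeas n)
    have hE : MeasurableSet E := measurableSet_le measurable_const ((hZ _).mono (hle _) le_rfl)
    have hSE : {ω | ∃ k ≤ n + 1, x ≤ Z k ω} = S ∪ (Sᶜ ∩ E) := by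
      ext ω
      simp only [S, E, Nat.le_succ_iff, mem_ofPred_eq, mem_union, mem_inter_iff, mem_compl_iff]
      constructor
      · rintro ⟨k, hk | rfl, h⟩
        · exact Or.inl ⟨k, hk, h⟩
        · by_cases h' : ∃ k ≤ n, x ≤ Z k ω
          · exact Or.inl h'
          · exact Or.inr ⟨h', h⟩
      · rintro (⟨k, hk, h⟩ | ⟨_, h⟩)
        · exact ⟨k, Or.inl hk, h⟩
        · exact ⟨n + 1, Or.inr rfl, h⟩
    have hcompl : (S ∪ (Sᶜ ∩ E))ᶜ = Sᶜ \ E := by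
      ext ω; simp only [mem_compl_iff, mem_union, mem_inter_iff, Set.mem_sdiff]; tauto
    rw [hSE, hcompl]
    calc x * μ (S ∪ (Sᶜ ∩ E)) + ∫⁻ ω in Sᶜ \ E, Z (n + 1) ω ∂μ
        ≤ x * (μ S + μ (Sᶜ ∩ E)) + ∫⁻ ω in Sᶜ \ E, Z (n + 1) ω ∂μ := by
          gcongr; exact measure_union_le _ _
      _ = x * μ S + (x * μ (Sᶜ ∩ E) + ∫⁻ ω in Sᶜ \ E, Z (n + 1) ω ∂μ) := by
          rw [mul_add, add_assoc]
      _ ≤ x * μ S + (∫⁻ ω in Sᶜ ∩ E, Z (n + 1) ω ∂μ + ∫⁻ ω in Sᶜ \ E, Z (n + 1) ω ∂μ) := by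
          gcongr
          exact hcheb _ _ (hS.compl.inter hE) fun ω h => h.2
      _ = x * μ S + ∫⁻ ω in Sᶜ, Z (n + 1) ω ∂μ := by
          rw [lintegral_inter_add_sdiff _ _ hE]
      _ ≤ x * μ S + ∫⁻ ω in Sᶜ, Z n ω ∂μ := by
          refine add_le_add_right ?_ _
          exact hstep n _ (MeasurableSet.compl (hmeas n))
      _ ≤ _ := ih

theorem mul_measure_exists_le {Z : ℕ → Ω → ℝ≥0∞} {m : ℕ → MeasurableSpace Ω}
    (hmono : Monotone m) (hle : ∀ k, m k ≤ mΩ) (hZ : ∀ k, Measurable[m k] (Z k))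
    (hstep : ∀ k A, MeasurableSet[m k] A → ∫⁻ ω in A, Z (k + 1) ω ∂μ ≤ ∫⁻ ω in A, Z k ω ∂μ)
    (x : ℝ≥0∞) :
    x * μ {ω | ∃ k, x ≤ Z k ω} ≤ ∫⁻ ω, Z 0 ω ∂μ := by
  have hU : {ω | ∃ k, x ≤ Z k ω} = ⋃ n, {ω | ∃ k ≤ n, x ≤ Z k ω} := by
    ext ω
    simp only [mem_ofPred_eq, mem_iUnion]
    exact ⟨fun ⟨k, h⟩ => ⟨k, k, le_rfl, h⟩, fun ⟨_, k, _, h⟩ => ⟨k, h⟩⟩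
  have hdir : Monotone fun n => {ω | ∃ k ≤ n, x ≤ Z k ω} :=
    fun _ _ hab _ ⟨k, hk, h⟩ => ⟨k, hk.trans hab, h⟩
  rw [hU, hdir.measure_iUnion, ENNReal.mul_iSup]
  exact iSup_le fun n => le_self_add.trans
    (mul_measure_exists_le_add_setLIntegral_le hmono hle hZ hstep x n)

/-- The maximal inequality for a right-continuous process in continuous time which is a
nonnegative supermartingale along the dyadic refinements of a grid. -/
theorem exists_measurableSet_mul_measure_le {Z : ℝ → Ω → ℝ≥0∞} {m : ℝ → MeasurableSpace Ω}
    {δ : ℝ} (hδ : 0 < δ) (hmono : Monotone m) (hle : ∀ t, m t ≤ mΩ)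
    (hZ : ∀ t, 0 ≤ t → Measurable[m t] (Z t))
    (hstep : ∀ (i k : ℕ) (A : Set Ω), MeasurableSet[m (k * (δ / 2 ^ i))] A →
      ∫⁻ ω in A, Z ((k + 1 : ℕ) * (δ / 2 ^ i)) ω ∂μ ≤ ∫⁻ ω in A, Z (k * (δ / 2 ^ i)) ω ∂μ)
    (hcont : ∀ ω t, 0 ≤ t → ContinuousWithinAt (fun t => Z t ω) (Ioi t) t) (x : ℝ≥0∞) :
    ∃ D, MeasurableSet D ∧ x * μ D ≤ ∫⁻ ω, Z 0 ω ∂μ ∧ ∀ ω ∉ D, ∀ t, 0 ≤ t → Z t ω ≤ x := by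
  set D : ℕ → Set Ω := fun i => {ω | ∃ k : ℕ, x ≤ Z (k * (δ / 2 ^ i)) ω} with hD
  have hDm : ∀ i, MeasurableSet (D i) := by
    intro i
    have : D i = ⋃ k : ℕ, {ω | x ≤ Z (k * (δ / 2 ^ i)) ω} := by ext; simp [hD]
    rw [this]
    exact MeasurableSet.iUnion fun k =>
      measurableSet_le measurable_const ((hZ _ (by positivity)).mono (hle _) le_rfl)
  have hDmono : Monotone D := by
    refine monotone_nat_of_le_succ fun i ω ⟨k, hk⟩ => ⟨2 * k, ?_⟩
    have : ((2 * k : ℕ) : ℝ) * (δ / 2 ^ (i + 1)) = k * (δ / 2 ^ i) := by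
      push_cast; field_simp; ring
    rwa [this]
  refine ⟨⋃ i, D i, MeasurableSet.iUnion hDm, ?_, ?_⟩
  · rw [hDmono.measure_iUnion, ENNReal.mul_iSup]
    refine iSup_le fun i => ?_
    have h := mul_measure_exists_le (μ := μ) (Z := fun k : ℕ => Z (k * (δ / 2 ^ i)))
      (m := fun k : ℕ => m (k * (δ / 2 ^ i)))
      (fun a b hab => hmono (by gcongr)) (fun k => hle _)
      (fun k => hZ _ (by positivity)) (hstep i) x
    simpa using h
  · intro ω hω t ht
    by_contra! hlt
    have hev : ∀ᶠ s in 𝓝[>] t, x < Z s ω := (hcont ω t ht).eventually (lt_mem_nhds hlt)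
    obtain ⟨η, hη, hsub⟩ := mem_nhdsGT_iff_exists_Ioo_subset.1 hev
    have hη' : 0 < η - t := sub_pos.2 hη
    obtain ⟨i, hi⟩ := pow_unbounded_of_one_lt (δ / (η - t)) (one_lt_two (α := ℝ))
    have hd : δ / 2 ^ i < η - t := by
      rw [div_lt_iff₀ hη'] at hi
      rw [div_lt_iff₀ (by positivity)]
      linarith
    have hd0 : 0 < δ / 2 ^ i := by positivity
    have h1 := Nat.lt_floor_add_one (t / (δ / 2 ^ i))
    have h2 := Nat.floor_le (div_nonneg ht hd0.le)
    rw [div_lt_iff₀ hd0] at h1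
    rw [le_div_iff₀ hd0] at h2
    refine hω (mem_iUnion.2 ⟨i, ⌊t / (δ / 2 ^ i)⌋₊ + 1, le_of_lt (hsub ⟨?_, ?_⟩)⟩)
    · push_cast; exact h1
    · push_cast
      linarith

end Maximal

/-- The constant in the passage from exponential tails to moments. -/
noncomputable def tailConst (p l : ℝ) : ℝ :=
  1 + 2 ^ p * ∑' n : ℕ, ((n : ℝ) + 1) ^ p * Real.exp (-l * n)

theorem summable_rpow_mul_exp {p l : ℝ} (hl : 0 < l) :
    Summable fun n : ℕ => ((n : ℝ) + 1) ^ p * Real.exp (-l * n) := by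
  have h := (summable_nat_add_iff 1).2 (Real.summable_pow_mul_exp_neg_nat_mul ⌈p⌉₊ hl)
  refine Summable.of_nonneg_of_le (fun n => by positivity) (fun n => ?_) (h.mul_left (Real.exp l))
  have h1 : ((n : ℝ) + 1) ^ p ≤ ((n : ℝ) + 1) ^ ⌈p⌉₊ := by
    rw [← Real.rpow_natCast]
    exact Real.rpow_le_rpow_of_exponent_le (by linarith [n.cast_nonneg (α := ℝ)]) (Nat.le_ceil p)
  have h2 : Real.exp (-l * n) = Real.exp l * Real.exp (-l * (n + 1 : ℕ)) := by
    rw [← Real.exp_add]; congr 1; push_cast; ring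
  rw [h2]
  push_cast
  calc ((n : ℝ) + 1) ^ p * (Real.exp l * Real.exp (-l * (n + 1)))
      = Real.exp l * (((n : ℝ) + 1) ^ p * Real.exp (-l * (n + 1))) := by ring
    _ ≤ _ := by gcongr

theorem tailConst_pos (p l : ℝ) : 0 < tailConst p l := by
  have : 0 ≤ ∑' n : ℕ, ((n : ℝ) + 1) ^ p * Real.exp (-l * n) := tsum_nonneg fun n => by positivity
  rw [tailConst]
  positivity

theorem add_rpow_le_mul {p m r : ℝ} (hp : 0 ≤ p) (hm : 0 ≤ m) (hr : 1 ≤ r) :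
    (m + r) ^ p ≤ 2 ^ p * (1 + m ^ p) * r ^ p := by
  rcases le_total m 1 with h | h
  · calc (m + r) ^ p ≤ (2 * r) ^ p := by gcongr; linarith
      _ = 2 ^ p * 1 * r ^ p := by rw [Real.mul_rpow (by norm_num) (by linarith)]; ring
      _ ≤ _ := by
        have : 0 ≤ m ^ p := by positivity
        gcongr; linarith
  · calc (m + r) ^ p ≤ (2 * m * r) ^ p := by gcongr; nlinarith
      _ = 2 ^ p * m ^ p * r ^ p := by
        rw [Real.mul_rpow (by positivity) (by linarith), Real.mul_rpow (by norm_num) hm]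
      _ ≤ _ := by gcongr; linarith

/-- A function with exponential tails has moments. -/
theorem lintegral_le_of_exp_tail {Ω : Type*} [MeasurableSpace Ω] {μ : Measure Ω}
    {F : Ω → ℝ≥0∞} {D : ℕ → Set Ω} [IsProbabilityMeasure μ]
    {p l m : ℝ} (hp : 0 ≤ p) (hl : 0 < l) (hm : 0 ≤ m) (hD : ∀ n, MeasurableSet (D n))
    (hμ : ∀ n : ℕ, μ (D n) ≤ ENNReal.ofReal (Real.exp (-l * n)))
    (hF : ∀ n : ℕ, ∀ᵐ ω ∂μ, ω ∉ D n → F ω ≤ ENNReal.ofReal ((m + n) ^ p)) :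
    ∫⁻ ω, F ω ∂μ ≤ ENNReal.ofReal (tailConst p l * (1 + m ^ p)) := by
  have hnull : ∀ᵐ ω ∂μ, ∃ n, ω ∉ D n := by
    have h0 : μ (⋂ n, D n) = 0 := by
      refine le_antisymm ?_ zero_le
      have ht : Tendsto (fun n : ℕ => ENNReal.ofReal (Real.exp (-l * n))) atTop (𝓝 0) := by
        rw [← ENNReal.ofReal_zero]
        refine ENNReal.tendsto_ofReal (Real.tendsto_exp_atBot.comp ?_)
        exact tendsto_natCast_atTop_atTop.const_mul_atTop_of_neg (by linarith)
      exact ge_of_tendsto' ht fun n => (measure_mono (iInter_subset _ n)).trans (hμ n)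
    rw [ae_iff]
    convert h0
    ext ω; simp
  have hpt : ∀ᵐ ω ∂μ, F ω ≤ ENNReal.ofReal (m ^ p) +
      ∑' n : ℕ, (D n).indicator (fun _ => ENNReal.ofReal ((m + (n + 1)) ^ p)) ω := by
    filter_upwards [hnull, ae_all_iff.2 hF] with ω hω hFω
    classical
    have hspec := Nat.find_spec hω
    rcases Nat.eq_zero_or_pos (Nat.find hω) with h0 | hpos
    · rw [h0] at hspec
      refine le_trans ?_ le_self_add
      simpa using hFω 0 hspec
    · obtain ⟨k, hk⟩ := Nat.exists_eq_succ_of_ne_zero hpos.ne'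
      have hmem : ω ∈ D k := by
        by_contra hcon
        exact absurd (Nat.find_min' hω hcon) (by omega)
      rw [hk] at hspec
      have h1 := hFω _ hspec
      have h2 := ENNReal.le_tsum
        (f := fun n : ℕ => (D n).indicator (fun _ => ENNReal.ofReal ((m + (n + 1)) ^ p)) ω) k
      simp only [indicator_of_mem hmem] at h2
      push_cast at h1
      exact h1.trans (h2.trans le_add_self)
  have hsum := summable_rpow_mul_exp (p := p) hl
  have hmp : 0 ≤ m ^ p := by positivity
  calc ∫⁻ ω, F ω ∂μ ≤ ∫⁻ ω, (ENNReal.ofReal (m ^ p) +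
      ∑' n : ℕ, (D n).indicator (fun _ => ENNReal.ofReal ((m + (n + 1)) ^ p)) ω) ∂μ :=
        lintegral_mono_ae hpt
    _ = ENNReal.ofReal (m ^ p) + ∑' n : ℕ, ENNReal.ofReal ((m + (n + 1)) ^ p) * μ (D n) := by
        rw [lintegral_add_left measurable_const, lintegral_const, measure_univ, mul_one,
          lintegral_tsum fun n => (measurable_const.indicator (hD n)).aemeasurable]
        congr 2
        ext n
        rw [lintegral_indicator_const (hD n)]
    _ ≤ ENNReal.ofReal (m ^ p) + ∑' n : ℕ, ENNReal.ofReal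
          (2 ^ p * (1 + m ^ p) * (((n : ℝ) + 1) ^ p * Real.exp (-l * n))) := by
        gcongr with n
        refine (mul_le_mul' (ENNReal.ofReal_le_ofReal
          (add_rpow_le_mul hp hm (by linarith [n.cast_nonneg (α := ℝ)]))) (hμ n)).trans ?_
        rw [← ENNReal.ofReal_mul (by positivity)]
        apply le_of_eq; congr 1; ring
    _ = ENNReal.ofReal (m ^ p + 2 ^ p * (1 + m ^ p) *
          ∑' n : ℕ, ((n : ℝ) + 1) ^ p * Real.exp (-l * n)) := by
        rw [← ENNReal.ofReal_tsum_of_nonneg (fun n => by positivity) (hsum.mul_left _),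
          tsum_mul_left, ← ENNReal.ofReal_add hmp]
        exact mul_nonneg (by positivity) (tsum_nonneg fun n => by positivity)
    _ ≤ _ := by
        refine ENNReal.ofReal_le_ofReal ?_
        rw [tailConst]
        nlinarith

/-- Jensen's inequality for a concave power. -/
theorem lintegral_rpow_le_rpow_lintegral {Ω : Type*} [MeasurableSpace Ω] {μ : Measure Ω}
    [IsProbabilityMeasure μ] {f : Ω → ℝ≥0∞} (hf : AEMeasurable f μ) {r : ℝ} (h0 : 0 < r)
    (h1 : r ≤ 1) : ∫⁻ ω, f ω ^ r ∂μ ≤ (∫⁻ ω, f ω ∂μ) ^ r := by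
  have h := eLpNorm'_le_eLpNorm'_of_exponent_le h0 h1 μ hf.aestronglyMeasurable
  simp only [eLpNorm', enorm_eq_self, ENNReal.rpow_one, div_one, one_div] at h
  exact (ENNReal.rpow_inv_le_iff h0).1 (by simpa using h)

/-- The flow from time `a` to time `t` of the linear stochastic subsystem along the path `w`. -/
noncomputable def linearFlow (υ σ : ℝ) (w : ℝ → ℝ) (a : ℝ) (z : ℝ × ℝ) (t : ℝ) : ℝ × ℝ :=
  (Real.exp (-(υ / 2) * (t - a)) * z.1 + noise (υ / 2) σ w a t,
    Real.exp (-(υ / 2) * (t - a)) * z.2)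

/-- The conservative step as a map of the phase space. -/
def ConservativeStep.map {υ : ℝ} (S : ConservativeStep υ) (z : ℝ × ℝ) : ℝ × ℝ := (S.ψ z, S.φ z)

/-- The numerical solution at the grid points, as a functional of the driving path. -/
noncomputable def gridState {υ : ℝ} (S : ConservativeStep υ) (σ τ : ℝ) (z₀ : ℝ × ℝ)
    (w : ℝ → ℝ) : ℕ → ℝ × ℝ
  | 0 => z₀
  | n + 1 => linearFlow υ σ w (n * τ) (S.map (gridState S σ τ z₀ w n)) ((n + 1) * τ)

/-- The inner process on the `n`-th cell, as a functional of the driving path. -/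
noncomputable def innerState {υ : ℝ} (S : ConservativeStep υ) (σ τ : ℝ) (z₀ : ℝ × ℝ)
    (w : ℝ → ℝ) (n : ℕ) (t : ℝ) : ℝ × ℝ :=
  linearFlow υ σ w (n * τ) (S.map (gridState S σ τ z₀ w n)) t

/-- The shifted Hamiltonian as a function on the phase space. -/
noncomputable def lyapunov (υ : ℝ) (z : ℝ × ℝ) : ℝ := shiftedHamiltonian υ z.1 z.2

/-- The shifted Hamiltonian along the inner processes. -/
noncomputable def lyapunovPath {υ : ℝ} (S : ConservativeStep υ) (σ τ : ℝ) (z₀ : ℝ × ℝ)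
    (w : ℝ → ℝ) (t : ℝ) : ℝ := lyapunov υ (innerState S σ τ z₀ w (gridIndex τ t) t)

theorem continuous_lyapunov (υ : ℝ) : Continuous (lyapunov υ) := by
  unfold lyapunov shiftedHamiltonian hamiltonian energy potential
  fun_prop

theorem lyapunov_nonneg (υ : ℝ) (z : ℝ × ℝ) : 0 ≤ lyapunov υ z := shiftedHamiltonian_nonneg _ _ _

theorem lyapunov_map {υ : ℝ} (S : ConservativeStep υ) (z : ℝ × ℝ) :
    lyapunov υ (S.map z) = lyapunov υ z := by
  simp only [lyapunov, shiftedHamiltonian, ConservativeStep.map]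
  rw [S.conserves z.1 z.2]

theorem measurable_map {υ : ℝ} (S : ConservativeStep υ) : Measurable S.map :=
  S.measurable_ψ.prodMk S.measurable_φ

theorem abs_rpow_add_abs_rpow_le {p : ℝ} (hp : 0 ≤ p) (υ : ℝ) (z : ℝ × ℝ) :
    |z.1| ^ (2 * p) + |z.2| ^ (4 * p) ≤ (4 ^ p + 8 ^ p) * lyapunov υ z ^ p := by
  have h := le_shiftedHamiltonian υ z.1 z.2
  have hV := lyapunov_nonneg υ z
  have e1 : |z.1| ^ (2 * p) = (z.1 ^ 2) ^ p := by
    rw [Real.rpow_mul (abs_nonneg _)]; norm_num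
  have e2 : |z.2| ^ (4 * p) = (z.2 ^ 4) ^ p := by
    rw [Real.rpow_mul (abs_nonneg _)]
    congr 1
    have : (4 : ℝ) = ((4 : ℕ) : ℝ) := by norm_num
    rw [this, Real.rpow_natCast]
    exact Even.pow_abs (by decide) _
  have h1 : z.1 ^ 2 ≤ 4 * lyapunov υ z := by
    have : 0 ≤ z.2 ^ 4 := by positivity
    rw [lyapunov]; linarith
  have h2 : z.2 ^ 4 ≤ 8 * lyapunov υ z := by
    have : 0 ≤ z.1 ^ 2 := by positivity
    rw [lyapunov]; linarith
  rw [e1, e2, add_mul, ← Real.mul_rpow (by norm_num) hV, ← Real.mul_rpow (by norm_num) hV]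
  gcongr

theorem linearFlow_self {υ σ a : ℝ} (hυ : 0 < υ) {w : ℝ → ℝ} (hw : Continuous w) (z : ℝ × ℝ) :
    linearFlow υ σ w a z a = z := by
  simp [linearFlow, noise_self (half_pos hυ).le hw]

theorem linearFlow_trans {υ σ a b t : ℝ} (hυ : 0 < υ) (hab : a ≤ b) (hbt : b ≤ t) {w : ℝ → ℝ}
    (hw : Continuous w) (z : ℝ × ℝ) :
    linearFlow υ σ w a z t = linearFlow υ σ w b (linearFlow υ σ w a z b) t := by
  have h1 : Real.exp (-(υ / 2) * (t - a))
      = Real.exp (-(υ / 2) * (t - b)) * Real.exp (-(υ / 2) * (b - a)) := by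
    rw [← Real.exp_add]; congr 1; ring
  simp only [linearFlow]
  rw [noise_trans (half_pos hυ).le hab hbt hw, h1]
  ext <;> ring

theorem continuousOn_linearFlow {υ σ a : ℝ} (hυ : 0 < υ) {w : ℝ → ℝ} (hw : Continuous w)
    (z : ℝ × ℝ) : ContinuousOn (linearFlow υ σ w a z) (Ici a) := by
  have h := continuousOn_noise (σ := σ) (a := a) (half_pos hυ).le hw
  have h1 : Continuous fun t => Real.exp (-(υ / 2) * (t - a)) * z.1 := by fun_prop
  have h2 : Continuous fun t => Real.exp (-(υ / 2) * (t - a)) * z.2 := by fun_prop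
  exact (h1.continuousOn.add h).prodMk h2.continuousOn

theorem SolvesLinearSDE.eq_linearFlow {υ σ a b x₀ y₀ : ℝ} (hυ : 0 < υ) {w x y : ℝ → ℝ}
    (hw : Continuous w) (h : SolvesLinearSDE υ σ a b x₀ y₀ w x y) {t : ℝ} (ht : t ∈ Icc a b) :
    (x t, y t) = linearFlow υ σ w a (x₀, y₀) t := by
  have h1 := eq_exp_mul_add_noise (half_pos hυ).le hw h.continuousOn_x h.x_eq ht
  have h2 := eq_exp_mul_add_noise (σ := 0) (half_pos hυ).le hw h.continuousOn_y
    (fun s hs => by rw [h.y_eq s hs]; ring) ht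
  have h3 : noise (υ / 2) 0 w a t = 0 := by simp [noise]
  rw [h3, add_zero] at h2
  rw [h1, h2, linearFlow]

theorem gridIndex_eq {τ t : ℝ} (hτ : 0 < τ) {n : ℕ} (h1 : n * τ ≤ t) (h2 : t < (n + 1) * τ) :
    gridIndex τ t = n := by
  have ht : 0 ≤ t := le_trans (by positivity) h1
  rw [gridIndex, Nat.floor_eq_iff (div_nonneg ht hτ.le), le_div_iff₀ hτ, div_lt_iff₀ hτ]
  exact ⟨h1, h2⟩

theorem gridIndex_mul_le {τ t : ℝ} (hτ : 0 < τ) (ht : 0 ≤ t) : gridIndex τ t * τ ≤ t :=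
  (isGreatest_gridIndex hτ ht).1

theorem lt_gridIndex_add_one_mul {τ : ℝ} (hτ : 0 < τ) (t : ℝ) : t < (gridIndex τ t + 1) * τ :=
  (div_lt_iff₀ hτ).1 (Nat.lt_floor_add_one _)

section Path

variable {υ σ τ : ℝ} {S : ConservativeStep υ} {z₀ : ℝ × ℝ} {w : ℝ → ℝ}

theorem innerState_start (hυ : 0 < υ) (hw : Continuous w) (n : ℕ) :
    innerState S σ τ z₀ w n (n * τ) = S.map (gridState S σ τ z₀ w n) :=
  linearFlow_self hυ hw _

theorem innerState_end (n : ℕ) :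
    innerState S σ τ z₀ w n ((n + 1) * τ) = gridState S σ τ z₀ w (n + 1) := rfl

theorem lyapunovPath_eq (hυ : 0 < υ) (hτ : 0 < τ) (hw : Continuous w) {n : ℕ} {t : ℝ}
    (h1 : n * τ ≤ t) (h2 : t ≤ (n + 1) * τ) :
    lyapunovPath S σ τ z₀ w t = lyapunov υ (innerState S σ τ z₀ w n t) := by
  rcases h2.lt_or_eq with h | h
  · rw [lyapunovPath, gridIndex_eq hτ h1 h]
  · have h3 : gridIndex τ t = n + 1 := by
      refine gridIndex_eq hτ (by push_cast; exact h.ge) ?_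
      rw [h]; push_cast; linarith
    have h4 : t = ((n + 1 : ℕ) : ℝ) * τ := by push_cast; exact h
    rw [lyapunovPath, h3]
    nth_rewrite 1 [h4]
    rw [innerState_start hυ hw, lyapunov_map, h, innerState_end]

theorem lyapunovPath_grid (hυ : 0 < υ) (hτ : 0 < τ) (hw : Continuous w) (n : ℕ) :
    lyapunovPath S σ τ z₀ w (n * τ) = lyapunov υ (gridState S σ τ z₀ w n) := by
  rw [lyapunovPath_eq hυ hτ hw le_rfl (by linarith), innerState_start hυ hw, lyapunov_map]

theorem continuousWithinAt_innerState (hυ : 0 < υ) (hτ : 0 < τ) (hw : Continuous w) {t : ℝ}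
    (ht : 0 ≤ t) :
    ContinuousWithinAt (fun s => innerState S σ τ z₀ w (gridIndex τ s) s) (Ioi t) t := by
  have h1 := gridIndex_mul_le hτ ht
  have h2 := lt_gridIndex_add_one_mul hτ t
  have h3 : ContinuousWithinAt (innerState S σ τ z₀ w (gridIndex τ t)) (Ioi t) t :=
    ((continuousOn_linearFlow hυ hw _) t h1).mono fun s hs => h1.trans (le_of_lt hs)
  refine h3.congr_of_eventuallyEq ?_ rfl
  filter_upwards [Ioo_mem_nhdsGT h2] with s hs
  rw [gridIndex_eq hτ (h1.trans hs.1.le) hs.2]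

theorem continuousWithinAt_lyapunovPath (hυ : 0 < υ) (hτ : 0 < τ) (hw : Continuous w) {t : ℝ}
    (ht : 0 ≤ t) : ContinuousWithinAt (lyapunovPath S σ τ z₀ w) (Ioi t) t :=
  (continuous_lyapunov υ).continuousAt.comp_continuousWithinAt
    (continuousWithinAt_innerState hυ hτ hw ht)

end Path

/-- The supremum over a compact interval of a right-continuous process is measurable. -/
theorem measurable_iSup_Icc {Ω : Type*} [MeasurableSpace Ω] {f : ℝ → Ω → ℝ≥0∞} (T : ℝ)
    (hm : ∀ t, 0 ≤ t → Measurable (f t))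
    (hc : ∀ ω t, 0 ≤ t → ContinuousWithinAt (fun s => f s ω) (Ioi t) t) :
    Measurable fun ω => ⨆ t ∈ Icc (0 : ℝ) T, f t ω := by
  set R : Set ℝ := Icc 0 T ∩ (range ((↑) : ℚ → ℝ) ∪ {T}) with hR
  have hRc : R.Countable := ((countable_range _).union (countable_singleton T)).mono inter_subset_right
  have heq : (fun ω => ⨆ t ∈ Icc (0 : ℝ) T, f t ω) = fun ω => ⨆ t ∈ R, f t ω := by
    ext ω
    refine le_antisymm (iSup₂_le fun t ht => ?_) (biSup_mono fun t ht => ht.1)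
    rcases ht.2.eq_or_lt with rfl | hlt
    · exact le_iSup₂ (f := fun s _ => f s ω) t ⟨ht, Or.inr rfl⟩
    · refine le_of_forall_lt fun c hcf => ?_
      obtain ⟨η, hη, hsub⟩ := mem_nhdsGT_iff_exists_Ioo_subset.1
        (((hc ω t ht.1).eventually (lt_mem_nhds hcf)).and (Ioo_mem_nhdsGT hlt))
      obtain ⟨q, hq1, hq2⟩ := exists_rat_btwn (show t < η from hη)
      obtain ⟨h1, h2⟩ := hsub ⟨hq1, hq2⟩
      exact lt_of_lt_of_le h1 (le_iSup₂ (f := fun s _ => f s ω) (q : ℝ)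
        ⟨⟨ht.1.trans h2.1.le, h2.2.le⟩, Or.inl ⟨q, rfl⟩⟩)
  rw [heq]
  exact Measurable.biSup _ hRc fun t ht => hm t ht.1.1

section NumericalProcess

variable {Ω : Type*} [MeasurableSpace Ω] {μ : Measure Ω} {B : ℝ → Ω → ℝ}
  {υ σ τ : ℝ} {S : ConservativeStep υ} {z₀ : ℝ × ℝ}

theorem measurable_past_linearFlow {Ω : Type*} {B : ℝ → Ω → ℝ} {υ σ a t : ℝ} (hυ : 0 < υ)
    (hat : a ≤ t) (hc : ∀ ω, Continuous fun s => B s ω) {z : Ω → ℝ × ℝ}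
    (hz : Measurable[past B a] z) :
    Measurable[past B t] fun ω => linearFlow υ σ (fun s => B s ω) a (z ω) t := by
  have h1 := measurable_past_noise (B := B) (σ := σ) (half_pos hυ).le hat hc
  have hz' : Measurable[past B t] z := hz.mono (past_mono B hat) le_rfl
  exact ((hz'.fst.const_mul _).add h1).prodMk (hz'.snd.const_mul _)

theorem measurable_past_gridState {Ω : Type*} {B : ℝ → Ω → ℝ} (hυ : 0 < υ) (hτ : 0 < τ)
    (hc : ∀ ω, Continuous fun s => B s ω) (n : ℕ) :
    Measurable[past B (n * τ)] fun ω => gridState S σ τ z₀ (fun s => B s ω) n := by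
  induction n with
  | zero => exact measurable_const
  | succ n ih =>
    have h := measurable_past_linearFlow (σ := σ) hυ (a := n * τ) (t := (n + 1) * τ)
      (by linarith) hc ((measurable_map S).comp ih)
    have e : ((n + 1 : ℕ) : ℝ) * τ = (n + 1) * τ := by push_cast; ring
    rw [e]
    exact h

theorem measurable_past_innerState {Ω : Type*} {B : ℝ → Ω → ℝ} (hυ : 0 < υ) (hτ : 0 < τ)
    (hc : ∀ ω, Continuous fun s => B s ω) {n : ℕ} {t : ℝ} (ht : n * τ ≤ t) :
    Measurable[past B t] fun ω => innerState S σ τ z₀ (fun s => B s ω) n t :=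
  measurable_past_linearFlow hυ ht hc
    ((measurable_map S).comp (measurable_past_gridState hυ hτ hc n))

theorem measurable_past_lyapunovPath {Ω : Type*} {B : ℝ → Ω → ℝ} (hυ : 0 < υ) (hτ : 0 < τ)
    (hc : ∀ ω, Continuous fun s => B s ω) {t : ℝ} (ht : 0 ≤ t) :
    Measurable[past B t] fun ω => lyapunovPath S σ τ z₀ (fun s => B s ω) t :=
  (continuous_lyapunov υ).measurable.comp
    (measurable_past_innerState hυ hτ hc (gridIndex_mul_le hτ ht))

theorem lintegral_mul_exp_lyapunovPath_le [IsProbabilityMeasure μ] (hB : IsRegularBrownian B μ)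
    (hυ : 0 < υ) (hσ : 0 < σ) (hτ : 0 < τ) (hτ1 : τ < 1) {n : ℕ} {a t : ℝ}
    (hna : n * τ ≤ a) (hat : a ≤ t) (htn : t ≤ (n + 1) * τ)
    {u : Ω → ℝ≥0∞} (hu : Measurable[past B a] u) :
    ∫⁻ ω, u ω * ENNReal.ofReal (Real.exp
        (expRate υ σ * lyapunovPath S σ τ z₀ (fun s => B s ω) t)) ∂μ
      ≤ ∫⁻ ω, u ω * ENNReal.ofReal (Real.exp ((1 - (1 - Real.exp (-υ)) / 2 * (t - a))
          * (expRate υ σ * lyapunovPath S σ τ z₀ (fun s => B s ω) a)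
          + growthRate υ σ * (t - a))) ∂μ := by
  have hz := measurable_past_innerState (S := S) (σ := σ) (z₀ := z₀) hυ hτ hB.continuous hna
  have h := lintegral_mul_exp_shiftedHamiltonian_le hB hυ hσ (a := a) (t := t)
    (le_trans (by positivity) hna) hat (by linarith) hu hz.fst hz.snd
  have h1 : ∀ ω, lyapunovPath S σ τ z₀ (fun s => B s ω) a
      = lyapunov υ (innerState S σ τ z₀ (fun s => B s ω) n a) := fun ω =>
    lyapunovPath_eq hυ hτ (hB.continuous ω) hna (hat.trans htn)
  have h2 : ∀ ω, lyapunovPath S σ τ z₀ (fun s => B s ω) t = lyapunov υ (linearFlow υ σ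
      (fun s => B s ω) a (innerState S σ τ z₀ (fun s => B s ω) n a) t) := fun ω => by
    rw [lyapunovPath_eq hυ hτ (hB.continuous ω) (hna.trans hat) htn, innerState,
      linearFlow_trans hυ hna hat (hB.continuous ω)]
    rfl
  simp only [h1, h2]
  exact h

/-- The exponential tail of the running maximum of the energy. -/
theorem exists_measurableSet_lyapunovPath_le [IsProbabilityMeasure μ]
    (hB : IsRegularBrownian B μ) (hυ : 0 < υ) (hσ : 0 < σ) (hτ : 0 < τ) (hτ1 : τ < 1) (r : ℝ) :
    ∃ D, MeasurableSet D ∧ μ D ≤ ENNReal.ofReal (Real.exp (-expRate υ σ * r)) ∧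
      ∀ ω ∉ D, ∀ t, 0 ≤ t → lyapunovPath S σ τ z₀ (fun s => B s ω) t
        ≤ lyapunov υ z₀ + growthRate υ σ / expRate υ σ * t + r := by
  set l := expRate υ σ with hl
  set g := growthRate υ σ with hg
  have hl0 : 0 < l := expRate_pos hυ hσ
  have hg0 : 0 < g := growthRate_pos hυ hσ
  set E : ℝ → Ω → ℝ := fun t ω => lyapunovPath S σ τ z₀ (fun s => B s ω) t with hE
  have hEm : ∀ t, 0 ≤ t → Measurable[past B t] (E t) := fun t ht =>
    measurable_past_lyapunovPath hυ hτ hB.continuous ht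
  have hstart : ∀ ω, E 0 ω = lyapunov υ z₀ := fun ω => by
    have := lyapunovPath_grid (S := S) (σ := σ) (z₀ := z₀) hυ hτ (hB.continuous ω) 0
    simpa [gridState] using this
  have hstep : ∀ (i k : ℕ) (A : Set Ω), MeasurableSet[past B (k * (τ / 2 ^ i))] A →
      ∫⁻ ω in A, ENNReal.ofReal (Real.exp (l * E ((k + 1 : ℕ) * (τ / 2 ^ i)) ω
          - g * ((k + 1 : ℕ) * (τ / 2 ^ i)))) ∂μ
        ≤ ∫⁻ ω in A, ENNReal.ofReal (Real.exp (l * E (k * (τ / 2 ^ i)) ω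
          - g * (k * (τ / 2 ^ i)))) ∂μ := by
    intro i k A hA
    set a : ℝ := k * (τ / 2 ^ i) with ha
    set t : ℝ := (k + 1 : ℕ) * (τ / 2 ^ i) with ht
    have h2i : (0 : ℝ) < 2 ^ i := by positivity
    have hat : a ≤ t := by rw [ha, ht]; push_cast; gcongr; linarith
    have ha0 : 0 ≤ a := by positivity
    have hna : ((k / 2 ^ i : ℕ) : ℝ) * τ ≤ a := by
      have h : ((k / 2 ^ i : ℕ) : ℝ) * 2 ^ i ≤ k := by exact_mod_cast Nat.div_mul_le_self k (2 ^ i)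
      rw [ha, ← mul_div_assoc, le_div_iff₀ h2i]
      nlinarith
    have htn : t ≤ (((k / 2 ^ i : ℕ) : ℝ) + 1) * τ := by
      have h : ((k + 1 : ℕ) : ℝ) ≤ (((k / 2 ^ i : ℕ) : ℝ) + 1) * 2 ^ i := by
        have := Nat.lt_div_mul_add (a := k) (b := 2 ^ i) (by positivity)
        have h' : k + 1 ≤ (k / 2 ^ i + 1) * 2 ^ i := by rw [add_mul, one_mul]; omega
        exact_mod_cast h'
      rw [ht, ← mul_div_assoc, div_le_iff₀ h2i]
      nlinarith
    have hA' : MeasurableSet A := hB.past_le a _ hA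
    rw [← lintegral_indicator hA', ← lintegral_indicator hA']
    have hu : Measurable[past B a] (A.indicator fun _ => ENNReal.ofReal (Real.exp (-g * t))) :=
      (@measurable_const _ _ _ (past B a) _).indicator hA
    have h := lintegral_mul_exp_lyapunovPath_le (S := S) (z₀ := z₀) hB hυ hσ hτ hτ1 hna hat htn hu
    refine le_trans (le_of_eq ?_) (h.trans (lintegral_mono fun ω => ?_))
    · refine lintegral_congr fun ω => ?_
      by_cases hω : ω ∈ A
      · simp only [indicator_of_mem hω]
        rw [← ENNReal.ofReal_mul (Real.exp_nonneg _), ← Real.exp_add]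
        congr 2; ring
      · simp [hω]
    · by_cases hω : ω ∈ A
      · simp only [indicator_of_mem hω]
        rw [← ENNReal.ofReal_mul (Real.exp_nonneg _), ← Real.exp_add]
        refine ENNReal.ofReal_le_ofReal (Real.exp_le_exp.2 ?_)
        have h1 : 0 ≤ (1 - Real.exp (-υ)) / 2 * (t - a) * (l * E a ω) :=
          mul_nonneg (mul_nonneg (half_pos (one_sub_exp_neg_pos hυ)).le (sub_nonneg.2 hat))
            (mul_nonneg hl0.le (lyapunov_nonneg _ _))
        simp only [hE] at h1 ⊢
        linarith
      · simp [hω]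
  have hcont : ∀ ω t, 0 ≤ t → ContinuousWithinAt
      (fun t => ENNReal.ofReal (Real.exp (l * E t ω - g * t))) (Ioi t) t := by
    intro ω t ht
    have h := continuousWithinAt_lyapunovPath (S := S) (σ := σ) (z₀ := z₀) hυ hτ
      (hB.continuous ω) ht
    refine ENNReal.continuous_ofReal.continuousAt.comp_continuousWithinAt
      (Real.continuous_exp.continuousAt.comp_continuousWithinAt ?_)
    exact (h.const_mul l).sub (Continuous.continuousWithinAt (by fun_prop))
  obtain ⟨D, hDm, hD, hle⟩ := exists_measurableSet_mul_measure_le (μ := μ)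
    (Z := fun t ω => ENNReal.ofReal (Real.exp (l * E t ω - g * t))) (m := past B) (δ := τ) hτ
    (past_mono B) hB.past_le
    (fun t ht => ENNReal.measurable_ofReal.comp
      (Real.measurable_exp.comp (((hEm t ht).const_mul l).sub_const _)))
    hstep hcont (ENNReal.ofReal (Real.exp (l * (lyapunov υ z₀ + r))))
  refine ⟨D, hDm, ?_, fun ω hω t ht => ?_⟩
  · simp only [hstart, lintegral_const, measure_univ, mul_one, mul_zero, sub_zero] at hD
    have h1 : ENNReal.ofReal (Real.exp (-l * r)) = ENNReal.ofReal (Real.exp (l * lyapunov υ z₀))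
        / ENNReal.ofReal (Real.exp (l * (lyapunov υ z₀ + r))) := by
      rw [← ENNReal.ofReal_div_of_pos (Real.exp_pos _), ← Real.exp_sub]
      congr 2; ring
    rw [h1, ENNReal.le_div_iff_mul_le (Or.inl (by simp [Real.exp_pos])) (Or.inl (by simp)),
      mul_comm]
    exact hD
  · have h1 := Real.exp_le_exp.1
      ((ENNReal.ofReal_le_ofReal_iff (Real.exp_nonneg _)).1 (hle ω hω t ht))
    have h2 : l * E t ω ≤ l * (lyapunov υ z₀ + g / l * t + r) := by
      have : l * (g / l * t) = g * t := by field_simp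
      linarith
    exact le_of_mul_le_mul_left h2 hl0

/-- The exponential moments of the energy are bounded uniformly in time. -/
theorem lintegral_exp_lyapunov_gridState_le [IsProbabilityMeasure μ]
    (hB : IsRegularBrownian B μ) (hυ : 0 < υ) (hσ : 0 < σ) (hτ : 0 < τ) (hτ1 : τ < 1) (n : ℕ) :
    ∫⁻ ω, ENNReal.ofReal (Real.exp
        (expRate υ σ * lyapunov υ (gridState S σ τ z₀ (fun s => B s ω) n))) ∂μ
      ≤ ENNReal.ofReal (Real.exp (expRate υ σ * lyapunov υ z₀
          + growthRate υ σ / ((1 - Real.exp (-υ)) / 2))) := by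
  set κ := (1 - Real.exp (-υ)) / 2 with hκ
  have hκ0 : 0 < κ := half_pos (one_sub_exp_neg_pos hυ)
  have hκ1 : κ < 1 := by have := Real.exp_pos (-υ); rw [hκ]; linarith
  have hl0 : 0 < expRate υ σ := expRate_pos hυ hσ
  have hg0 : 0 < growthRate υ σ := growthRate_pos hυ hσ
  set l := expRate υ σ
  set g := growthRate υ σ
  induction n with
  | zero =>
    simp only [gridState, lintegral_const, measure_univ, mul_one]
    refine ENNReal.ofReal_le_ofReal (Real.exp_le_exp.2 ?_)
    have : 0 ≤ g / κ := by positivity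
    linarith
  | succ n ih =>
    set V : ℕ → Ω → ℝ := fun n ω => lyapunov υ (gridState S σ τ z₀ (fun s => B s ω) n) with hV
    have hVm : Measurable (V n) := (continuous_lyapunov υ).measurable.comp
      ((measurable_past_gridState hυ hτ hB.continuous n).mono (hB.past_le _) le_rfl)
    have hκτ : κ * τ < 1 := by nlinarith
    have h := lintegral_mul_exp_lyapunovPath_le (S := S) (z₀ := z₀) hB hυ hσ hτ hτ1 (n := n)
      (a := n * τ) (t := (n + 1) * τ) le_rfl (by linarith) le_rfl (u := fun _ => 1)
      (@measurable_const _ _ _ (past B _) _)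
    have e1 : ∀ ω, lyapunovPath S σ τ z₀ (fun s => B s ω) ((n + 1) * τ) = V (n + 1) ω := by
      intro ω
      have := lyapunovPath_grid (S := S) (σ := σ) (z₀ := z₀) hυ hτ (hB.continuous ω) (n + 1)
      push_cast at this
      exact this
    have e2 : ∀ ω, lyapunovPath S σ τ z₀ (fun s => B s ω) (n * τ) = V n ω := fun ω =>
      lyapunovPath_grid hυ hτ (hB.continuous ω) n
    have e3 : ((n : ℝ) + 1) * τ - n * τ = τ := by ring
    simp only [e1, e2, e3, one_mul] at h
    refine h.trans ?_
    have e4 : ∀ ω, ENNReal.ofReal (Real.exp ((1 - κ * τ) * (l * V n ω) + g * τ))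
        = ENNReal.ofReal (Real.exp (g * τ)) *
          ENNReal.ofReal (Real.exp (l * V n ω)) ^ (1 - κ * τ) := by
      intro ω
      rw [ENNReal.ofReal_rpow_of_pos (Real.exp_pos _), ← Real.exp_mul,
        ← ENNReal.ofReal_mul (Real.exp_nonneg _), ← Real.exp_add]
      congr 2; ring
    calc ∫⁻ ω, ENNReal.ofReal (Real.exp ((1 - κ * τ) * (l * V n ω) + g * τ)) ∂μ
        = ENNReal.ofReal (Real.exp (g * τ)) *
          ∫⁻ ω, ENNReal.ofReal (Real.exp (l * V n ω)) ^ (1 - κ * τ) ∂μ := by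
          simp only [e4]
          rw [lintegral_const_mul' _ _ (by simp)]
      _ ≤ ENNReal.ofReal (Real.exp (g * τ)) *
          (ENNReal.ofReal (Real.exp (l * lyapunov υ z₀ + g / κ))) ^ (1 - κ * τ) := by
          refine mul_le_mul_right ((lintegral_rpow_le_rpow_lintegral ?_ (by linarith) ?_).trans
            (ENNReal.rpow_le_rpow ih (by linarith))) _
          · exact (ENNReal.measurable_ofReal.comp
              (Real.measurable_exp.comp (hVm.const_mul l))).aemeasurable
          · have := mul_pos hκ0 hτ
            linarith
      _ ≤ _ := by
          rw [ENNReal.ofReal_rpow_of_pos (Real.exp_pos _), ← Real.exp_mul,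
            ← ENNReal.ofReal_mul (Real.exp_nonneg _), ← Real.exp_add]
          refine ENNReal.ofReal_le_ofReal (Real.exp_le_exp.2 ?_)
          have h1 : 0 ≤ κ * τ * (l * lyapunov υ z₀) :=
            mul_nonneg (by positivity) (mul_nonneg hl0.le (lyapunov_nonneg _ _))
          have h2 : g / κ * (κ * τ) = g * τ := by field_simp
          linarith

end NumericalProcess

/-- The constant in the moment bounds, when the energy exceeds its initial value by at most `r`
up to an exponential tail. -/
noncomputable def momentConst (p l r : ℝ) : ℝ :=
  (4 ^ p + 8 ^ p) * (tailConst p l * (1 + 2 ^ p * r ^ p))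

theorem momentConst_pos {p l r : ℝ} (hr : 0 ≤ r) : 0 < momentConst p l r := by
  have := tailConst_pos p l
  rw [momentConst]
  positivity

theorem lintegral_le_momentConst {Ω : Type*} [MeasurableSpace Ω] {μ : Measure Ω}
    [IsProbabilityMeasure μ] {F : Ω → ℝ≥0∞} {D : ℕ → Set Ω} {p l s υ : ℝ} {z : ℝ × ℝ}
    (hp : 0 ≤ p) (hl : 0 < l) (hs : 0 ≤ s) (hD : ∀ n, MeasurableSet (D n))
    (hμ : ∀ n : ℕ, μ (D n) ≤ ENNReal.ofReal (Real.exp (-l * n)))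
    (hF : ∀ n : ℕ, ∀ᵐ ω ∂μ, ω ∉ D n →
      F ω ≤ ENNReal.ofReal ((4 ^ p + 8 ^ p) * (lyapunov υ z + s + n) ^ p)) :
    ∫⁻ ω, F ω ∂μ ≤ ENNReal.ofReal
      (momentConst p l (υ ^ 4 / 8 + 1 + s) * (1 + |hamiltonian υ z.1 z.2| ^ p)) := by
  set k : ℝ := 4 ^ p + 8 ^ p with hk
  have hk0 : 0 < k := by positivity
  have hk1 : ENNReal.ofReal k ≠ 0 := by simpa using hk0
  have hV := lyapunov_nonneg υ z
  have h := lintegral_le_of_exp_tail (F := fun ω => (ENNReal.ofReal k)⁻¹ * F ω) hp hl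
    (add_nonneg hV hs) hD hμ (fun n => by
      filter_upwards [hF n] with ω h1 h2
      rw [ENNReal.inv_mul_le_iff hk1 ENNReal.ofReal_ne_top, ← ENNReal.ofReal_mul hk0.le]
      exact h1 h2)
  rw [lintegral_const_mul' _ _ (ENNReal.inv_ne_top.2 hk1),
    ENNReal.inv_mul_le_iff hk1 ENNReal.ofReal_ne_top, ← ENNReal.ofReal_mul hk0.le] at h
  refine h.trans (ENNReal.ofReal_le_ofReal ?_)
  have hT := tailConst_pos p l
  set H := |hamiltonian υ z.1 z.2|
  set r := υ ^ 4 / 8 + 1 + s with hr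
  have hr1 : 1 ≤ r := by
    have : 0 ≤ υ ^ 4 := by positivity
    rw [hr]; linarith
  have hm : lyapunov υ z + s ≤ H + r := by
    have : lyapunov υ z = hamiltonian υ z.1 z.2 + (υ ^ 4 / 8 + 1) := rfl
    have h2 : hamiltonian υ z.1 z.2 ≤ H := le_abs_self _
    rw [this, hr]; linarith
  have h1 : (lyapunov υ z + s) ^ p ≤ 2 ^ p * (1 + H ^ p) * r ^ p :=
    (Real.rpow_le_rpow (by positivity) hm hp).trans (add_rpow_le_mul hp (abs_nonneg _) hr1)
  have hH : 0 ≤ H ^ p := by positivity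
  calc k * (tailConst p l * (1 + (lyapunov υ z + s) ^ p))
      ≤ k * (tailConst p l * ((1 + H ^ p) + 2 ^ p * (1 + H ^ p) * r ^ p)) := by
        gcongr; linarith
    _ = _ := by rw [momentConst]; ring

theorem IsNumericalSolution.ae_eq_gridState_and_innerState {Ω : Type*} [MeasurableSpace Ω]
    {μ : Measure Ω} {W : ℝ≥0 → Ω → ℝ} {υ σ τ : ℝ} {S : ConservativeStep υ} {P₀ Q₀ : ℝ}
    {P Q : ℕ → Ω → ℝ} {Pt Qt : ℕ → ℝ → Ω → ℝ} {B : ℝ → Ω → ℝ}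
    (h : IsNumericalSolution μ W υ σ τ S P₀ Q₀ P Q Pt Qt) (hυ : 0 < υ) (hτ : 0 < τ)
    (hB : ∀ ω, Continuous fun t => B t ω) (hBW : ∀ᵐ ω ∂μ, ∀ t, B t ω = W t.toNNReal ω) :
    ∀ᵐ ω ∂μ, ∀ n : ℕ, (P n ω, Q n ω) = gridState S σ τ (P₀, Q₀) (fun t => B t ω) n ∧
      ∀ t ∈ Icc (n * τ) ((n + 1) * τ),
        (Pt n t ω, Qt n t ω) = innerState S σ τ (P₀, Q₀) (fun t => B t ω) n t := by
  filter_upwards [h.init, h.inner, h.step, hBW] with ω h0 hin hst hw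
  have hinner : ∀ n : ℕ, (P n ω, Q n ω) = gridState S σ τ (P₀, Q₀) (fun t => B t ω) n →
      ∀ t ∈ Icc (n * τ) ((n + 1) * τ),
        (Pt n t ω, Qt n t ω) = innerState S σ τ (P₀, Q₀) (fun t => B t ω) n t := by
    intro n hn t ht
    have h1 := hin n
    simp only [← hw] at h1
    rw [h1.eq_linearFlow hυ (hB ω) ht, innerState, ← hn]
    rfl
  have hgrid : ∀ n : ℕ, (P n ω, Q n ω) = gridState S σ τ (P₀, Q₀) (fun t => B t ω) n := by
    intro n
    induction n with
    | zero => rw [h0.1, h0.2]; rfl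
    | succ n ih =>
      rw [(hst n).1, (hst n).2]
      exact hinner n ih _ ⟨by linarith, le_rfl⟩
  exact fun n => ⟨hgrid n, hinner n (hgrid n)⟩

end SplitLangevin

open SplitLangevin in
theorem lemma2p1 (υ σ : ℝ) (hυ : 0 < υ) (hσ : 0 < σ) (p : ℝ) (hp : 1 ≤ p) :
    ∃ (C : ℝ → ℝ) (K : ℝ), (∀ T : ℝ, 0 < T → 0 < C T) ∧ 0 < K ∧
      ∀ (τ : ℝ), 0 < τ → τ < 1 →
      ∀ (S : SplitLangevin.ConservativeStep υ)
        (Ω : Type*) [MeasurableSpace Ω] (μ : Measure Ω) [IsProbabilityMeasure μ]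
        (W : ℝ≥0 → Ω → ℝ), ProbabilityTheory.IsBrownianReal W μ →
      ∀ (P₀ Q₀ : ℝ) (P Q : ℕ → Ω → ℝ) (Pt Qt : ℕ → ℝ → Ω → ℝ),
        SplitLangevin.IsNumericalSolution μ W υ σ τ S P₀ Q₀ P Q Pt Qt →
        (∀ T : ℝ, 0 < T →
          AEMeasurable (fun ω => ⨆ t ∈ Icc (0 : ℝ) T, ENNReal.ofReal
            (|Pt (SplitLangevin.gridIndex τ t) t ω| ^ (2 * p)
              + |Qt (SplitLangevin.gridIndex τ t) t ω| ^ (4 * p))) μ ∧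
          (∫⁻ ω, ⨆ t ∈ Icc (0 : ℝ) T, ENNReal.ofReal
            (|Pt (SplitLangevin.gridIndex τ t) t ω| ^ (2 * p)
              + |Qt (SplitLangevin.gridIndex τ t) t ω| ^ (4 * p)) ∂μ)
            ≤ ENNReal.ofReal (C T * (1 + |SplitLangevin.hamiltonian υ P₀ Q₀| ^ p))) ∧
        (∀ n : ℕ, AEMeasurable (P n) μ ∧ AEMeasurable (Q n) μ) ∧
        (⨆ n : ℕ, ∫⁻ ω, ENNReal.ofReal (|P n ω| ^ (2 * p) + |Q n ω| ^ (4 * p)) ∂μ)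
          ≤ ENNReal.ofReal (K * (1 + |SplitLangevin.hamiltonian υ P₀ Q₀| ^ p)) := by
  have hp0 : 0 ≤ p := by linarith
  have hl0 : 0 < expRate υ σ := expRate_pos hυ hσ
  have hg0 : 0 < growthRate υ σ := growthRate_pos hυ hσ
  have hκ0 : 0 < (1 - Real.exp (-υ)) / 2 := half_pos (one_sub_exp_neg_pos hυ)
  refine ⟨fun T => momentConst p (expRate υ σ)
      (υ ^ 4 / 8 + 1 + growthRate υ σ / expRate υ σ * T),
    momentConst p (expRate υ σ) (υ ^ 4 / 8 + 1
      + growthRate υ σ / ((1 - Real.exp (-υ)) / 2) / expRate υ σ),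
    fun T hT => momentConst_pos (by positivity), momentConst_pos (by positivity), ?_⟩
  intro τ hτ hτ1 S Ω _ μ _ W hW P₀ Q₀ P Q Pt Qt hsol
  obtain ⟨B, hB, hBW⟩ := exists_isRegularBrownian hW
  have hae := hsol.ae_eq_gridState_and_innerState hυ hτ hB.continuous hBW
  have hgm : ∀ n, Measurable fun ω => gridState S σ τ (P₀, Q₀) (fun t => B t ω) n := fun n =>
    (measurable_past_gridState hυ hτ hB.continuous n).mono (hB.past_le _) le_rfl
  have hfc : Continuous fun z : ℝ × ℝ =>
      ENNReal.ofReal (|z.1| ^ (2 * p) + |z.2| ^ (4 * p)) :=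
    ENNReal.continuous_ofReal.comp
      ((continuous_fst.abs.rpow_const fun _ => Or.inr (by positivity)).add
        (continuous_snd.abs.rpow_const fun _ => Or.inr (by positivity)))
  refine ⟨fun T hT => ⟨?_, ?_⟩, fun n => ⟨?_, ?_⟩, iSup_le fun n => ?_⟩
  · refine ⟨_, measurable_iSup_Icc T (f := fun t ω => (fun z : ℝ × ℝ =>
      ENNReal.ofReal (|z.1| ^ (2 * p) + |z.2| ^ (4 * p)))
      (innerState S σ τ (P₀, Q₀) (fun t => B t ω) (gridIndex τ t) t)) (fun t ht => ?_)
      (fun ω t ht => ?_), ?_⟩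
    · exact hfc.measurable.comp ((measurable_past_innerState hυ hτ hB.continuous
        (gridIndex_mul_le hτ ht)).mono (hB.past_le _) le_rfl)
    · exact hfc.continuousAt.comp_continuousWithinAt
        (continuousWithinAt_innerState hυ hτ (hB.continuous ω) ht)
    · filter_upwards [hae] with ω hω
      refine biSup_congr fun t ht => ?_
      rw [← (hω (gridIndex τ t)).2 t
        ⟨gridIndex_mul_le hτ ht.1, (lt_gridIndex_add_one_mul hτ t).le⟩]
  · choose D hDm hDμ hDle using fun n : ℕ => exists_measurableSet_lyapunovPath_le
      (S := S) (z₀ := (P₀, Q₀)) hB hυ hσ hτ hτ1 (n : ℝ)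
    refine lintegral_le_momentConst (z := (P₀, Q₀)) hp0 hl0 (by positivity) hDm hDμ fun n => ?_
    filter_upwards [hae] with ω hω hωD
    refine iSup₂_le fun t ht => ENNReal.ofReal_le_ofReal ?_
    have h1 := (hω (gridIndex τ t)).2 t
        ⟨gridIndex_mul_le hτ ht.1, (lt_gridIndex_add_one_mul hτ t).le⟩
    have h2 := abs_rpow_add_abs_rpow_le hp0 υ
      (innerState S σ τ (P₀, Q₀) (fun t => B t ω) (gridIndex τ t) t)
    have h3 := hDle n ω hωD t ht.1
    rw [← h1] at h2
    refine h2.trans ?_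
    rw [h1]
    gcongr
    · exact lyapunov_nonneg _ _
    · refine h3.trans ?_
      gcongr
      exact ht.2
  · refine ⟨_, (hgm n).fst, ?_⟩
    filter_upwards [hae] with ω hω
    rw [← (hω n).1]
  · refine ⟨_, (hgm n).snd, ?_⟩
    filter_upwards [hae] with ω hω
    rw [← (hω n).1]
  · set V : Ω → ℝ := fun ω => lyapunov υ (gridState S σ τ (P₀, Q₀) (fun t => B t ω) n)
    have hVm : Measurable V := (continuous_lyapunov υ).measurable.comp (hgm n)
    set l := expRate υ σ
    set s := growthRate υ σ / ((1 - Real.exp (-υ)) / 2) / l with hs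
    have hexp := lintegral_exp_lyapunov_gridState_le (S := S) (z₀ := (P₀, Q₀)) hB hυ hσ hτ hτ1 n
    have hls : l * s = growthRate υ σ / ((1 - Real.exp (-υ)) / 2) := by
      rw [hs]; field_simp
    rw [← hls] at hexp
    refine lintegral_le_momentConst (z := (P₀, Q₀)) (υ := υ) (s := s) (l := l)
      (D := fun j => {ω | lyapunov υ (P₀, Q₀) + s + j < V ω}) hp0 hl0 (by positivity)
      (fun j => measurableSet_lt measurable_const hVm) (fun j => ?_) fun j => ?_
    · have hm := meas_ge_le_lintegral_div (μ := μ)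
        (f := fun ω => ENNReal.ofReal (Real.exp (l * V ω))) (by fun_prop)
        (ε := ENNReal.ofReal (Real.exp (l * (lyapunov υ (P₀, Q₀) + s + j))))
        (by simp [Real.exp_pos]) (by simp)
      refine (measure_mono ?_).trans (hm.trans ((ENNReal.div_le_div_right hexp _).trans ?_))
      · intro ω hω
        refine ENNReal.ofReal_le_ofReal (Real.exp_le_exp.2 ?_)
        exact mul_le_mul_of_nonneg_left (le_of_lt hω) hl0.le
      · rw [← ENNReal.ofReal_div_of_pos (Real.exp_pos _), ← Real.exp_sub]
        refine ENNReal.ofReal_le_ofReal (Real.exp_le_exp.2 (le_of_eq ?_))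
        ring
    · filter_upwards [hae] with ω hω hωD
      refine ENNReal.ofReal_le_ofReal ?_
      have h2 := abs_rpow_add_abs_rpow_le hp0 υ
        (gridState S σ τ (P₀, Q₀) (fun t => B t ω) n)
      have h3 : V ω ≤ lyapunov υ (P₀, Q₀) + s + j := not_lt.1 hωD
      rw [← (hω n).1] at h2
      refine h2.trans ?_
      rw [(hω n).1]
      gcongr
      exact lyapunov_nonneg _ _
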